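/- Let $0\le \ell<d<n$ be integers and write $[a:b]=\{a,\dots,b\}$. For positive integers $N_1,\dots,N_d,K,T,S$, an $(n,d,N_1,\dots,N_d,K,T,S)$ code consists of message-encoding functions $f_i:\prod_{j=1}^d[1:N_j]\times[1:K]\to[1:T]$ for $i\in[1:n]$; message-decoding functions $g_{\mathcal A}:[1:T]^{|\mathcal A|}\to[1:N_{|\mathcal A|}]$ for $\mathcal A\subseteq[1:n]$ with $|\mathcal A|\in[1:d]$; and, for each $i\in[1:n]$ and each $\mathcal B\subseteq[1:n]\setminus\{i\}$ with $|\mathcal B|=d$, repair-encoding functions $f^{\mathcal B}_{i'\to i}:[1:T]\to[1:S]$ for $i'\in\mathcal B$ and a repair-decoding function $g_i^{\mathcal B}:[1:S]^d\to[1:T]$. Let the messages $\mathsf M_j$ (uniform on $[1:N_j]$) and the key $\mathsf K$ (uniform on $[1:K]$) be mutually independent, and put $\mathsf W_i=f_i(\mathsf M_1,\dots,\mathsf M_d,\mathsf K)$, $\mathsf S^{\mathcal B}_{i'\to i}=f^{\mathcal B}_{i'\to i}(\mathsf W_{i'})$, $\mathsf S_{\to i}=(\mathsf S^{\mathcal B}_{i'\to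 i}:\mathcal B\not\ni i,\ |\mathcal B|=d,\ i'\in\mathcal B)$. A tuple $(\bar B_{\ell+1},\dots,\bar B_d,\bar\alpha,\bar\beta)$ is achievable for the $(n,d,\ell)$ multilevel diversity coding with secure regeneration (MDC-SR) problem if there is such a code with $N_j=1$ for all $j\in[1:\ell]$ and $\Sigma:=\sum_{t=\ell+1}^d\log N_t>0$ such that: $\bar\alpha=\log T/\Sigma$, $\bar\beta=\log S/\Sigma$ and $\bar B_j=\log N_j/\Sigma$ for $j\in[\ell+1:d]$; $\mathsf M_{|\mathcal A|}=g_{\mathcal A}(\mathsf W_i:i\in\mathcal A)$ whenever $|\mathcal A|\in[\ell+1:d]$; $\mathsf W_i=g_i^{\mathcal B}(\mathsf S^{\mathcal B}_{i'\to i}:i'\in\mathcal B)$ for all $i$ and all $\mathcal B\not\ni i$ with $|\mathcal B|=d$; and $I((\mathsf M_{\ell+1},\dots,\mathsf M_d);(\mathsf S_{\to i}:i\in\mathcal E))=0$ for every $\mathcal E\subseteq[1:n]$ with $|\mathcal E|=\ell$. Let $\mathcal R_{n,d,\ell}\subseteq\mathbb R^{d-\ell+2}$ be the closure of the set of achievable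 tuples; let $\mathcal R_{n,d,\ell}(\bar B_{\ell+1},\dots,\bar B_d)$ be the set of pairs $(\bar\alpha,\bar\beta)$ with $(\bar B_{\ell+1},\dots,\bar B_d,\bar\alpha,\bar\beta)\in\mathcal R_{n,d,\ell}$; and, for $j\in[\ell+1:d]$, let $\mathcal R_{n,j,d,\ell}$ (the region of the $(n,j,d,\ell)$ secure regenerating code (SRC) problem) be this set for $\bar B_j=1$ and $\bar B_t=0$ ($t\ne j$). The separate-coding region $\hat{\mathcal R}_{n,d,\ell}(\bar B_{\ell+1},\dots,\bar B_d)$ is the set of all pairs $\big(\sum_{j=\ell+1}^d\bar\alpha_j\bar B_j,\sum_{j=\ell+1}^d\bar\beta_j\bar B_j\big)$ with $(\bar\alpha_j,\bar\beta_j)\in\mathcal R_{n,j,d,\ell}$ for each $j$. The minimum-bandwidth-regenerating (MBR) point of a set of pairs $(\bar\alpha,\bar\beta)$ is its element with the least $\bar\beta$ and, among the elements with this $\bar\beta$, the least $\bar\alpha$. Put $T_{d,k,\ell}=\sum_{t=\ell+1}^k(d+1-t)$. **Theorem.** 1. Every $(\bar B_{\ell+1},\dots,\bar B_d,\bar\alpha,\bar\beta)\in\mathcal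 R_{n,d,\ell}$ satisfies $$\bar\beta\ \ge\ \sum_{j=\ell+1}^dT_{d,j,\ell}^{-1}\bar B_j,\qquad \bar\alpha+(d(d-\ell)-\ell)\bar\beta\ \ge\ (d-\ell)(d+1)\sum_{j=\ell+1}^dT_{d,j,\ell}^{-1}\bar B_j .$$ 2. Set as equalities, the two bounds intersect exactly at $(\bar\alpha,\bar\beta)=\big(d\sum_{j=\ell+1}^dT_{d,j,\ell}^{-1}\bar B_j,\ \sum_{j=\ell+1}^dT_{d,j,\ell}^{-1}\bar B_j\big)$. 3. For every $j\in[\ell+1:d]$, the Shah–Rashmi–Kumar (SRK) point satisfies $(dT_{d,j,\ell}^{-1},T_{d,j,\ell}^{-1})\in\mathcal R_{n,j,d,\ell}$. 4. Separate coding achieves the MBR point: for all $\bar B_{\ell+1},\dots,\bar B_d\ge0$ with $\sum_{j=\ell+1}^d\bar B_j=1$, the point in 2 is the MBR point of $\mathcal R_{n,d,\ell}(\bar B_{\ell+1},\dots,\bar B_d)$, and it belongs to $\hat{\mathcal R}_{n,d,\ell}(\bar B_{\ell+1},\dots,\bar B_d)$. -/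

import Mathlib

namespace MDCSR

noncomputable section

/-! ## Shannon entropy of random variables on a finite uniform probability space -/

/-- The probability that `X = x`, for `X` defined on a finite sample space `Ω` carrying the
uniform distribution. -/
def prob {Ω γ : Type} [Fintype Ω] (X : Ω → γ) (x : γ) : ℝ :=
  (Nat.card {ω : Ω // X ω = x} : ℝ) / (Fintype.card Ω : ℝ)

open scoped Classical in
/-- The Shannon entropy `H(X)` (in nats), summed over the values that `X` takes. -/
def entropy {Ω γ : Type} [Fintype Ω] (X : Ω → γ) : ℝ :=
  ∑ x ∈ Finset.univ.image X, Real.negMulLog (prob X x)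

/-- The mutual information `I(X;Y) = H(X) + H(Y) - H(X,Y)`. -/
def mutualInfo {Ω γ δ : Type} [Fintype Ω] (X : Ω → γ) (Y : Ω → δ) : ℝ :=
  entropy X + entropy Y - entropy (fun ω => (X ω, Y ω))

/-! ## Codes -/

/-- The index set `[a : b] = {a, a+1, …, b}`. -/
abbrev Level (a b : ℕ) : Type := ↥(Finset.Icc a b)

theorem mem_all {ℓ d j : ℕ} (h : j ∈ Finset.Icc (ℓ + 1) d) : j ∈ Finset.Icc 1 d := by
  simp only [Finset.mem_Icc] at h ⊢
  omega

/-- The inclusion of `[ℓ+1 : d]` in `[1 : d]`. -/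
def Level.incl {ℓ d : ℕ} (j : Level (ℓ + 1) d) : Level 1 d := ⟨j.1, mem_all j.2⟩

/-- The repair groups of node `i`: the sets of `d` nodes that do not contain `i`. -/
abbrev RepairGroup (n d : ℕ) (i : Fin n) : Type :=
  {B : Finset (Fin n) // B.card = d ∧ i ∉ B}

/-- An `(n, d, N_1, …, N_d, K, T, S)` code; the finite sets `[1 : m]` are modelled by `Fin m`. -/
structure Code (n d : ℕ) (N : Level 1 d → ℕ) (K T S : ℕ) where
  /-- The message-encoding functions `f_i`. -/
  enc : Fin n → ((j : Level 1 d) → Fin (N j)) × Fin K → Fin T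
  /-- The message-decoding functions `g_A`, for `|A| ∈ [1 : d]`. -/
  dec : (A : Finset (Fin n)) → (hA : A.card ∈ Finset.Icc 1 d) → (A → Fin T) → Fin (N ⟨A.card, hA⟩)
  /-- The repair-encoding functions `f^B_{i' → i}`; the arguments are `i`, `B`, `i'` in this
  order. -/
  repairEnc : (i : Fin n) → (B : RepairGroup n d i) → B.1 → Fin T → Fin S
  /-- The repair-decoding functions `g^B_i`; the arguments are `i`, `B` in this order. -/
  repairDec : (i : Fin n) → (B : RepairGroup n d i) → (B.1 → Fin S) → Fin T

/-- The sample space: the messages `(M_1, …, M_d)` and the key. Under the uniform distribution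
on it, the messages and the key are uniform and mutually independent. -/
abbrev Sample {d : ℕ} (N : Level 1 d → ℕ) (K : ℕ) : Type :=
  ((j : Level 1 d) → Fin (N j)) × Fin K

namespace Code

variable {n d : ℕ} {N : Level 1 d → ℕ} {K T S : ℕ}

/-- The data `W_i` stored at node `i`. -/
def stored (c : Code n d N K T S) (i : Fin n) (ω : Sample N K) : Fin T := c.enc i ω

/-- The data `S^B_{i' → i}` downloaded from node `i'` to repair node `i` with repair group `B`. -/
def download (c : Code n d N K T S) (i : Fin n) (B : RepairGroup n d i) (i' : B.1)
    (ω : Sample N K) : Fin S :=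
  c.repairEnc i B i' (c.stored i'.1 ω)

/-- The collection `(S_{→ i} : i ∈ E)` of everything that can be downloaded to repair the nodes
in `E`, under all possible repair groups. -/
def eavesdropped (c : Code n d N K T S) (E : Finset (Fin n)) (ω : Sample N K) :
    (i : E) → (B : RepairGroup n d i.1) → B.1 → Fin S :=
  fun i B i' => c.download i.1 B i' ω

/-- Message recovery: `M_{|A|}` is decoded from the nodes in `A` whenever `|A| ∈ [ℓ+1 : d]`. -/
def MessageRecovery (ℓ : ℕ) (c : Code n d N K T S) : Prop :=
  ∀ (A : Finset (Fin n)) (hA : A.card ∈ Finset.Icc (ℓ + 1) d) (ω : Sample N K),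
    c.dec A (mem_all hA) (fun i => c.stored i.1 ω) = ω.1 ⟨A.card, mem_all hA⟩

/-- Node regeneration: `W_i` is recovered from the downloads of every repair group of `i`. -/
def NodeRegeneration (c : Code n d N K T S) : Prop :=
  ∀ (i : Fin n) (B : RepairGroup n d i) (ω : Sample N K),
    c.repairDec i B (fun i' => c.download i B i' ω) = c.stored i ω

/-- Repair secrecy: `I((M_{ℓ+1}, …, M_d); (S_{→ i} : i ∈ E)) = 0` whenever `|E| = ℓ`. -/
def RepairSecrecy (ℓ : ℕ) (c : Code n d N K T S) : Prop :=
  ∀ E : Finset (Fin n), E.card = ℓ →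
    mutualInfo (fun (ω : Sample N K) (j : Level (ℓ + 1) d) => ω.1 j.incl) (c.eavesdropped E) = 0

end Code

/-! ## Achievable tuples and tradeoff regions -/

/-- The space of tuples `((B̄_{ℓ+1}, …, B̄_d), ᾱ, β̄)`. -/
abbrev Tuple (d ℓ : ℕ) : Type := (Level (ℓ + 1) d → ℝ) × ℝ × ℝ

/-- The tuple `((B̄_{ℓ+1}, …, B̄_d), ᾱ, β̄)` is achievable for the `(n, d, ℓ)` MDC-SR problem. -/
def Achievable (n d ℓ : ℕ) (p : Tuple d ℓ) : Prop :=
  ∃ (N : Level 1 d → ℕ) (K T S : ℕ) (c : Code n d N K T S),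
    (∀ j, 0 < N j) ∧ 0 < K ∧ 0 < T ∧ 0 < S ∧
    (∀ j : Level 1 d, j.1 ≤ ℓ → N j = 1) ∧
    0 < ∑ t : Level (ℓ + 1) d, Real.log (N t.incl) ∧
    Real.log T / ∑ t : Level (ℓ + 1) d, Real.log (N t.incl) = p.2.1 ∧
    Real.log S / ∑ t : Level (ℓ + 1) d, Real.log (N t.incl) = p.2.2 ∧
    (∀ j : Level (ℓ + 1) d,
      Real.log (N j.incl) / ∑ t : Level (ℓ + 1) d, Real.log (N t.incl) = p.1 j) ∧
    c.MessageRecovery ℓ ∧ c.NodeRegeneration ∧ c.RepairSecrecy ℓ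

/-- The region `R_{n,d,ℓ}`: the closure of the set of achievable tuples. -/
def region (n d ℓ : ℕ) : Set (Tuple d ℓ) := closure {p | Achievable n d ℓ p}

/-- The region `R_{n,d,ℓ}(B̄_{ℓ+1}, …, B̄_d)` of pairs `(ᾱ, β̄)`. -/
def regionAt (n d ℓ : ℕ) (B : Level (ℓ + 1) d → ℝ) : Set (ℝ × ℝ) :=
  {q | (B, q) ∈ region n d ℓ}

/-- The region `R_{n,k,d,ℓ}` of the `(n, k, d, ℓ)` SRC problem: the message rates are `B̄_k = 1`
and `B̄_j = 0` for `j ≠ k`. -/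
def srcRegion (n d ℓ : ℕ) (k : Level (ℓ + 1) d) : Set (ℝ × ℝ) :=
  regionAt n d ℓ (Pi.single k 1)

/-- The separate-coding region: each message `M_j` is encoded by its own `(n, j, d, ℓ)` SRC. -/
def separateRegion (n d ℓ : ℕ) (B : Level (ℓ + 1) d → ℝ) : Set (ℝ × ℝ) :=
  {q | ∃ r : Level (ℓ + 1) d → ℝ × ℝ, (∀ j, r j ∈ srcRegion n d ℓ j) ∧
    q = (∑ j, (r j).1 * B j, ∑ j, (r j).2 * B j)}

/-- `p = (ᾱ, β̄)` is the minimum-bandwidth-regenerating point of a region `R`: it has the least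
`β̄` in `R`, and the least `ᾱ` among the points of `R` with this `β̄`. -/
def IsMBRPoint (R : Set (ℝ × ℝ)) (p : ℝ × ℝ) : Prop :=
  p ∈ R ∧ ∀ q ∈ R, p.2 ≤ q.2 ∧ (q.2 = p.2 → p.1 ≤ q.1)

/-- `T_{d,k,ℓ} = ∑_{t=ℓ+1}^{k} (d + 1 - t)`. -/
def Tsum (d k ℓ : ℕ) : ℝ := ∑ t ∈ Finset.Icc (ℓ + 1) k, ((d : ℝ) + 1 - (t : ℝ))

/-- `∑_{j=ℓ+1}^{d} T_{d,j,ℓ}⁻¹ B̄_j`. -/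
def rateSum (d ℓ : ℕ) (B : Level (ℓ + 1) d → ℝ) : ℝ :=
  ∑ j : Level (ℓ + 1) d, (Tsum d j.1 ℓ)⁻¹ * B j

end

end MDCSR

/-! Converse. Fix `d + 1` nodes, so that each has exactly one repair group among the others. Let `M
j` be the messages of level at most `j`. Summing over all orderings of these nodes, let `G j k` be
the entropy of `M j` with all repair data of the first `k` nodes. Let `Q j k` add the content of the
next node, and `Z j k` one download to the next node. Repair data of a node determine its content,
hence everything it sends, so submodularity yields three inequalities (`repairSum_succ_sub_le`,
`storedSum_succ_le`, `repairSum_add_two_le`). They force `(G j (k+1) - G j k) / (d - k)` to decrease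
in `k`, so `(G j k - G j ℓ) / Tsum d k ℓ` decreases as well.

The levels are then chained. Repair data of `j + 1` nodes decode the message of level `j + 1`, so `G
j (j+1) = G (j+1) (j+1)`. By secrecy that message adds its full entropy to `G j ℓ`. Passing from
level `j` to `j + 1` thus releases one term `b (j+1) / Tsum d (j+1) ℓ`, and the chain starts from an
increment of at most `β`: this is the first bound. The second runs the same chain on a potential
that also carries `Q`.

Achievability. A symmetric `d × d` product matrix `Φ` over a prime field has key symbols in its
first `ℓ` rows and columns, message symbols in the rest of the first `j`, and zeros elsewhere. Node
`i` stores `Φ ψ_i` with `ψ_i` a Vandermonde vector, and `i'` sends `ψ_i ⬝ Φ ψ_{i'}` to `i`. One such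
code carries `Tsum d j ℓ` message symbols, `d` stored symbols and one symbol per download: the SRK
point. Running many copies for each level, in proportions tending to `B j / Tsum d j ℓ`, gives the
intersection point for every `B`.

The two bounds then identify the MBR point, which is the combination of the SRK points with weights
`B j`. -/

namespace MDCSR

open Finset

/-! ### Entropy of partitions of a finite uniform space -/

section Entropy

variable {Ω : Type} [Fintype Ω]

open scoped Classical in
/-- The size of the class of `ω`. -/
noncomputable def classCard (r : Setoid Ω) (ω : Ω) : ℕ := #{ω' | r ω' ω}

/-- The entropy of the partition of a uniform finite probability space into the classes of `r`. -/
noncomputable def partEntropy (r : Setoid Ω) : ℝ :=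
  (Fintype.card Ω : ℝ)⁻¹ * ∑ ω, (Real.log (Fintype.card Ω) - Real.log (classCard r ω))

theorem classCard_pos (r : Setoid Ω) (ω : Ω) : 0 < classCard r ω :=
  card_pos.2 ⟨ω, by simp⟩

theorem classCard_congr (r : Setoid Ω) {ω ω' : Ω} (h : r ω ω') :
    classCard r ω = classCard r ω' := by
  unfold classCard
  congr 1
  ext a
  simp only [mem_filter, mem_univ, true_and]
  exact ⟨fun h' => r.trans h' h, fun h' => r.trans h' (r.symm h)⟩

/-- In the order on setoids, `r ≤ s` means that `r` is finer, so that `s` is a function of `r`; `⊓`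
is the joint variable and `⊤` the constant one. -/
theorem partEntropy_anti {r s : Setoid Ω} (h : r ≤ s) : partEntropy s ≤ partEntropy r := by
  unfold partEntropy
  gcongr with ω
  · exact_mod_cast classCard_pos r ω
  · unfold classCard
    gcongr with a
    exact fun h' => h h'

theorem partEntropy_top : partEntropy (⊤ : Setoid Ω) = 0 := by
  have h (ω : Ω) : classCard (⊤ : Setoid Ω) ω = Fintype.card Ω := by
    simp [classCard, Finset.card_univ]
  simp [partEntropy, h]

theorem partEntropy_bot [Nonempty Ω] :
    partEntropy (⊥ : Setoid Ω) = Real.log (Fintype.card Ω) := by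
  have h (ω : Ω) : classCard (⊥ : Setoid Ω) ω = 1 := by
    simp only [classCard, Setoid.bot_def]
    rw [card_eq_one]
    exact ⟨ω, by ext; simp⟩
  have := Fintype.card_ne_zero (α := Ω)
  simp [partEntropy, h]

open scoped Classical in
theorem sum_inv_classCard_filter (r : Setoid Ω) (ω : Ω) :
    ∑ a with r a ω, (classCard r a : ℝ)⁻¹ = 1 := by
  have h : ∀ a ∈ ({a | r a ω} : Finset Ω), (classCard r a : ℝ)⁻¹ = (classCard r ω : ℝ)⁻¹ := by
    intro a ha
    rw [classCard_congr r (by simpa using ha)]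
  rw [sum_congr rfl h, sum_const, nsmul_eq_mul]
  exact mul_inv_cancel₀ (by exact_mod_cast (classCard_pos r ω).ne')

/-- Double counting. The product of class sizes counts pairs `(a, b)` with `a` in the `r`-class and
`b` in the `s`-class of `ω`. For fixed `(a, b)` the admissible `ω` form one class of `r ⊓ s` or
none, so the first weight sums to at most `1`; `b` then lies in the `p`-class of `a`, which absorbs
the second weight. With `log x ≤ x - 1` this gives submodularity. -/
theorem sum_submodular_ratio_le {r s p : Setoid Ω} (hr : r ≤ p) (hs : s ≤ p) :
    ∑ ω, ((classCard r ω : ℝ) * classCard s ω) * ((classCard (r ⊓ s) ω : ℝ)⁻¹ *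
      (classCard p ω : ℝ)⁻¹) ≤ Fintype.card Ω := by
  classical
  have h1 (ω : Ω) : ((classCard r ω : ℝ) * classCard s ω) * ((classCard (r ⊓ s) ω : ℝ)⁻¹ *
      (classCard p ω : ℝ)⁻¹) = ∑ a, ∑ b, if r a ω ∧ s b ω then
        (classCard (r ⊓ s) ω : ℝ)⁻¹ * (classCard p a : ℝ)⁻¹ else 0 := by
    have h2 : (classCard r ω : ℝ) * classCard s ω = ∑ a, ∑ b, if r a ω ∧ s b ω then 1 else 0 := by
      unfold classCard
      rw [card_filter, card_filter]
      push_cast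
      rw [sum_mul_sum]
      refine sum_congr rfl fun a _ => sum_congr rfl fun b _ => ?_
      by_cases ha : r a ω <;> by_cases hb : s b ω <;> simp [ha, hb]
    rw [h2, sum_mul]
    refine sum_congr rfl fun a _ => ?_
    rw [sum_mul]
    refine sum_congr rfl fun b _ => ?_
    split_ifs with h
    · rw [one_mul, classCard_congr p (hr h.1)]
    · simp
  simp_rw [h1]
  rw [sum_comm]
  have h3 (a : Ω) : ∑ ω, ∑ b, (if r a ω ∧ s b ω then
      (classCard (r ⊓ s) ω : ℝ)⁻¹ * (classCard p a : ℝ)⁻¹ else 0) ≤ 1 := by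
    rw [sum_comm]
    have h4 (b : Ω) : ∑ ω, (if r a ω ∧ s b ω then
        (classCard (r ⊓ s) ω : ℝ)⁻¹ * (classCard p a : ℝ)⁻¹ else 0) ≤
        if p b a then (classCard p a : ℝ)⁻¹ else 0 := by
      by_cases hex : ∃ ω₀, r a ω₀ ∧ s b ω₀
      · obtain ⟨ω₀, h5, h6⟩ := hex
        rw [if_pos (p.trans (hs h6) (p.symm (hr h5)))]
        have h7 (ω : Ω) : (r a ω ∧ s b ω) ↔ (r ⊓ s) ω ω₀ := by
          exact ⟨fun h => ⟨r.trans (r.symm h.1) h5, s.trans (s.symm h.2) h6⟩,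
            fun h => ⟨r.trans h5 (r.symm h.1), s.trans h6 (s.symm h.2)⟩⟩
        simp_rw [h7]
        rw [← sum_filter, ← sum_mul, sum_inv_classCard_filter, one_mul]
      · push Not at hex
        rw [sum_eq_zero]
        · split_ifs <;> positivity
        · intro ω _
          rw [if_neg]
          exact fun h => hex ω h.1 h.2
    refine (sum_le_sum fun b _ => h4 b).trans ?_
    rw [← sum_filter, sum_const, nsmul_eq_mul]
    exact (mul_inv_cancel₀ (by exact_mod_cast (classCard_pos p a).ne')).le
  refine (sum_le_sum fun a _ => h3 a).trans ?_
  simp [Finset.card_univ]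

/-- Submodularity of the entropy. -/
theorem partEntropy_submodular {r s p : Setoid Ω} (hr : r ≤ p) (hs : s ≤ p) :
    partEntropy (r ⊓ s) + partEntropy p ≤ partEntropy r + partEntropy s := by
  unfold partEntropy
  rw [← mul_add, ← mul_add, ← sum_add_distrib, ← sum_add_distrib]
  refine mul_le_mul_of_nonneg_left ?_ (by positivity)
  rw [← sub_nonneg, ← sum_sub_distrib]
  have h (ω : Ω) : 1 - ((classCard r ω : ℝ) * classCard s ω) * ((classCard (r ⊓ s) ω : ℝ)⁻¹ *
      (classCard p ω : ℝ)⁻¹) ≤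
      Real.log (Fintype.card Ω) - Real.log (classCard r ω) +
      (Real.log (Fintype.card Ω) - Real.log (classCard s ω)) -
      (Real.log (Fintype.card Ω) - Real.log (classCard (r ⊓ s) ω) +
      (Real.log (Fintype.card Ω) - Real.log (classCard p ω))) := by
    have h1 : (0 : ℝ) < classCard r ω := by exact_mod_cast classCard_pos r ω
    have h2 : (0 : ℝ) < classCard s ω := by exact_mod_cast classCard_pos s ω
    have h3 : (0 : ℝ) < classCard (r ⊓ s) ω := by exact_mod_cast classCard_pos _ ω
    have h4 : (0 : ℝ) < classCard p ω := by exact_mod_cast classCard_pos p ω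
    have := Real.log_le_sub_one_of_pos (x := ((classCard r ω : ℝ) * classCard s ω) *
      ((classCard (r ⊓ s) ω : ℝ)⁻¹ * (classCard p ω : ℝ)⁻¹)) (by positivity)
    rw [Real.log_mul (by positivity) (by positivity), Real.log_mul h1.ne' h2.ne',
      Real.log_mul (by positivity) (by positivity), Real.log_inv, Real.log_inv] at this
    linarith
  refine le_trans ?_ (sum_le_sum fun ω _ => h ω)
  rw [sum_sub_distrib]
  have := sum_submodular_ratio_le hr hs
  simp only [sum_const, Finset.card_univ, nsmul_eq_mul, mul_one]
  linarith

theorem partEntropy_inf_le (r s : Setoid Ω) :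
    partEntropy (r ⊓ s) ≤ partEntropy r + partEntropy s := by
  have := partEntropy_submodular (le_top (a := r)) (le_top (a := s))
  rwa [partEntropy_top, add_zero] at this

theorem partEntropy_ker_le {γ : Type} [Fintype γ] [Nonempty Ω] (X : Ω → γ) :
    partEntropy (Setoid.ker X) ≤ Real.log (Fintype.card γ) := by
  classical
  have : Nonempty γ := ⟨X (Classical.arbitrary Ω)⟩
  have hγ : (0 : ℝ) < Fintype.card γ := by exact_mod_cast Fintype.card_pos
  have hΩ : (0 : ℝ) < Fintype.card Ω := by exact_mod_cast Fintype.card_pos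
  -- The left side is the number of classes, that is, of values taken by `X`.
  have hsum : ∑ ω, (classCard (Setoid.ker X) ω : ℝ)⁻¹ ≤ Fintype.card γ := by
    rw [← sum_fiberwise univ X]
    have h1 (x : γ) : ∑ ω with X ω = x, (classCard (Setoid.ker X) ω : ℝ)⁻¹ ≤ 1 := by
      by_cases hex : ∃ ω₀, X ω₀ = x
      · obtain ⟨ω₀, rfl⟩ := hex
        exact (sum_inv_classCard_filter (Setoid.ker X) ω₀).le
      · push Not at hex
        rw [filter_false_of_mem fun ω _ => hex ω, sum_empty]
        exact zero_le_one
    refine (sum_le_sum fun x _ => h1 x).trans ?_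
    simp [Finset.card_univ]
  unfold partEntropy
  rw [inv_mul_le_iff₀ hΩ]
  have h (ω : Ω) : Real.log (Fintype.card Ω) - Real.log (classCard (Setoid.ker X) ω) ≤
      Real.log (Fintype.card γ) +
        (Fintype.card Ω * (Fintype.card γ : ℝ)⁻¹ * (classCard (Setoid.ker X) ω : ℝ)⁻¹ - 1) := by
    have h1 : (0 : ℝ) < classCard (Setoid.ker X) ω := by exact_mod_cast classCard_pos _ ω
    have := Real.log_le_sub_one_of_pos (x := Fintype.card Ω * (Fintype.card γ : ℝ)⁻¹ *
      (classCard (Setoid.ker X) ω : ℝ)⁻¹) (by positivity)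
    rw [Real.log_mul (by positivity) (by positivity), Real.log_mul (by positivity) (by positivity),
      Real.log_inv, Real.log_inv] at this
    linarith
  refine (sum_le_sum fun ω _ => h ω).trans ?_
  rw [sum_add_distrib, sum_sub_distrib, ← mul_sum]
  have h2 : Fintype.card Ω * (Fintype.card γ : ℝ)⁻¹ *
      ∑ ω, (classCard (Setoid.ker X) ω : ℝ)⁻¹ ≤ Fintype.card Ω := by
    calc _ ≤ Fintype.card Ω * (Fintype.card γ : ℝ)⁻¹ * Fintype.card γ := by gcongr
      _ = _ := by field_simp
  simp only [sum_const, Finset.card_univ, nsmul_eq_mul, mul_one]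
  linarith

theorem entropy_eq_partEntropy {γ : Type} [Nonempty Ω] (X : Ω → γ) :
    entropy X = partEntropy (Setoid.ker X) := by
  classical
  have hΩ : (0 : ℝ) < Fintype.card Ω := by exact_mod_cast Fintype.card_pos
  have hp (ω : Ω) : prob X (X ω) = classCard (Setoid.ker X) ω / Fintype.card Ω := by
    unfold prob classCard
    rw [Nat.card_eq_fintype_card, Fintype.card_subtype]
    congr!
  unfold entropy partEntropy
  rw [mul_sum]
  rw [← sum_fiberwise_of_maps_to (s := univ) (t := univ.image X) (g := X)
    (fun ω _ => mem_image_of_mem X (mem_univ ω))]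
  refine sum_congr (by congr!) fun x hx => ?_
  obtain ⟨ω₀, -, rfl⟩ := mem_image.1 hx
  have h1 : ∀ ω ∈ ({ω | X ω = X ω₀} : Finset Ω), (Fintype.card Ω : ℝ)⁻¹ *
      (Real.log (Fintype.card Ω) - Real.log (classCard (Setoid.ker X) ω)) =
      (Fintype.card Ω : ℝ)⁻¹ *
      (Real.log (Fintype.card Ω) - Real.log (classCard (Setoid.ker X) ω₀)) := by
    intro ω hω
    rw [classCard_congr (Setoid.ker X) (by simpa [Setoid.ker_def] using hω)]
  have h2 : (0 : ℝ) < classCard (Setoid.ker X) ω₀ := by exact_mod_cast classCard_pos _ _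
  have h3 : #{ω | X ω = X ω₀} = classCard (Setoid.ker X) ω₀ := by
    unfold classCard
    congr!
  rw [sum_congr rfl h1, sum_const, h3, nsmul_eq_mul, hp, Real.negMulLog,
    Real.log_div h2.ne' hΩ.ne']
  field_simp
  ring

omit [Fintype Ω] in
theorem ker_pair {γ δ : Type} (X : Ω → γ) (Y : Ω → δ) :
    Setoid.ker (fun ω => (X ω, Y ω)) = Setoid.ker X ⊓ Setoid.ker Y := by
  ext a b
  simp [Setoid.ker_def, Setoid.inf_iff_and]

theorem mutualInfo_eq {γ δ : Type} [Nonempty Ω] (X : Ω → γ) (Y : Ω → δ) :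
    mutualInfo X Y = partEntropy (Setoid.ker X) + partEntropy (Setoid.ker Y) -
      partEntropy (Setoid.ker X ⊓ Setoid.ker Y) := by
  rw [mutualInfo, entropy_eq_partEntropy, entropy_eq_partEntropy, entropy_eq_partEntropy, ker_pair]

/-- Independence passes to coarser partitions. -/
theorem partEntropy_inf_eq_of_le {r r' s s' : Setoid Ω} (hr : r ≤ r') (hs : s ≤ s')
    (h : partEntropy r + partEntropy s - partEntropy (r ⊓ s) = 0) :
    partEntropy (r' ⊓ s') = partEntropy r' + partEntropy s' := by
  refine le_antisymm (partEntropy_inf_le _ _) ?_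
  -- Coarsening one variable at a time cannot increase the mutual information: first `r` to `r'`,
  -- then `s` to `s'`.
  have h1 := partEntropy_submodular (r := r' ⊓ s) (s := r) (p := r') inf_le_left hr
  have h2 : r' ⊓ s ⊓ r = r ⊓ s := by
    rw [inf_right_comm, inf_eq_right.2 hr]
  have h3 := partEntropy_submodular (r := r' ⊓ s') (s := s) (p := s') inf_le_right hs
  have h4 : r' ⊓ s' ⊓ s = r' ⊓ s := by
    rw [inf_assoc, inf_eq_right.2 hs]
  rw [h2] at h1
  rw [h4] at h3
  linarith

theorem partEntropy_inf_finset_inf_le {ι : Type} (C : Finset ι) (p : Setoid Ω) (f : ι → Setoid Ω) :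
    partEntropy (p ⊓ C.inf f) - partEntropy p ≤
      ∑ y ∈ C, (partEntropy (p ⊓ f y) - partEntropy p) := by
  classical
  induction C using Finset.induction_on with
  | empty => simp
  | insert a C ha ih =>
    rw [sum_insert ha, inf_insert]
    have := partEntropy_submodular (r := p ⊓ f a) (s := p ⊓ C.inf f) (p := p) inf_le_left
      inf_le_left
    rw [show p ⊓ f a ⊓ (p ⊓ C.inf f) = p ⊓ (f a ⊓ C.inf f) by
      rw [← inf_inf_distrib_left]] at this
    linarith

end Entropy

end MDCSR

namespace MDCSR

open Finset

/-! ### Arithmetic of `Tsum` -/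

theorem Tsum_self (d ℓ : ℕ) : Tsum d ℓ ℓ = 0 := by simp [Tsum]

theorem Tsum_succ {d k ℓ : ℕ} (h : ℓ ≤ k) : Tsum d (k + 1) ℓ = Tsum d k ℓ + (d - k) := by
  unfold Tsum
  rw [Finset.sum_Icc_succ_top (by omega)]
  push_cast
  ring

theorem Tsum_nonneg {d k ℓ : ℕ} (h : k ≤ d) : 0 ≤ Tsum d k ℓ := by
  unfold Tsum
  refine sum_nonneg fun t ht => ?_
  have : (t : ℝ) ≤ d := by exact_mod_cast (mem_Icc.1 ht).2.trans h
  linarith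

theorem Tsum_pos {d k ℓ : ℕ} (h : k ≤ d) (h' : ℓ < k) : 0 < Tsum d k ℓ := by
  obtain ⟨k, rfl⟩ : ∃ k', k = k' + 1 := ⟨k - 1, by omega⟩
  rw [Tsum_succ (by omega)]
  have h1 := Tsum_nonneg (d := d) (k := k) (ℓ := ℓ) (by omega)
  have : (k : ℝ) + 1 ≤ d := by exact_mod_cast h
  linarith

theorem Tsum_le {d k ℓ : ℕ} (h : ℓ ≤ k) (hk : k ≤ d) :
    Tsum d k ℓ ≤ ((d : ℝ) + 1) * (d - ℓ) := by
  have h1 : (k : ℝ) ≤ d := by exact_mod_cast hk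
  have h2 : (ℓ : ℝ) ≤ k := by exact_mod_cast h
  suffices Tsum d k ℓ ≤ ((d : ℝ) + 1) * (k - ℓ) from
    this.trans (mul_le_mul_of_nonneg_left (by linarith) (by positivity))
  clear hk h1 h2
  induction k, h using Nat.le_induction with
  | base => simp [Tsum_self]
  | succ k hk ih =>
    rw [Tsum_succ hk]
    push_cast
    have : (0 : ℝ) ≤ k := by positivity
    linarith

/-! ### Consequences of the three averaged inequalities at one level -/

section SingleLevel

variable {d ℓ : ℕ} {G Q Z : ℕ → ℝ}

/-- The increments of the averaged entropies decay at least linearly. -/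
theorem increment_decay
    (h1 : ∀ k < d, G (k + 1) - G k ≤ (d - k) * (Z k - G k))
    (h3 : ∀ k < d, G (k + 2) ≤ 2 * G (k + 1) - Z k) {k : ℕ} (hk : k < d) :
    (d - k) * (G (k + 2) - G (k + 1)) ≤ (d - (k + 1)) * (G (k + 1) - G k) := by
  have hk' : (0 : ℝ) ≤ d - k := by
    have : (k : ℝ) < d := by exact_mod_cast hk
    linarith
  have := mul_le_mul_of_nonneg_left (h3 k hk) hk'
  linarith [h1 k hk]

/-- Write `G k - G ℓ` as the sum of `(d - t) δ_t` over `ℓ ≤ t < k`, with `δ_t` the normalized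
increment. As `δ` is decreasing, each `δ_t` is at least `δ_k`, and the weights `d - t` add up to
`Tsum d k ℓ`. -/
theorem increment_le_average
    (h1 : ∀ k < d, G (k + 1) - G k ≤ (d - k) * (Z k - G k))
    (h3 : ∀ k < d, G (k + 2) ≤ 2 * G (k + 1) - Z k) {k : ℕ} (hℓ : ℓ ≤ k) (hk : k ≤ d) :
    Tsum d k ℓ * (G (k + 1) - G k) ≤ (d - k) * (G k - G ℓ) := by
  induction k, hℓ using Nat.le_induction with
  | base => simp [Tsum_self]
  | succ k hℓk ih =>
    have ih := ih (by omega)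
    have hd := increment_decay h1 h3 (k := k) (by omega)
    have hk1 : (k : ℝ) + 1 ≤ d := by exact_mod_cast hk
    have hT := Tsum_nonneg (d := d) (k := k) (ℓ := ℓ) (by omega)
    have hpos : (0 : ℝ) < d - k := by linarith
    rw [Tsum_succ hℓk]
    push_cast
    have a1 := mul_le_mul_of_nonneg_left hd hT
    have a2 := mul_le_mul_of_nonneg_left ih (show (0 : ℝ) ≤ d - (k + 1) by linarith)
    refine le_of_mul_le_mul_left ?_ hpos
    have a3 := mul_le_mul_of_nonneg_left hd hpos.le
    nlinarith

theorem average_anti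
    (h1 : ∀ k < d, G (k + 1) - G k ≤ (d - k) * (Z k - G k))
    (h3 : ∀ k < d, G (k + 2) ≤ 2 * G (k + 1) - Z k) {k : ℕ} (hℓ : ℓ ≤ k) (hk : k < d) :
    Tsum d k ℓ * (G (k + 1) - G ℓ) ≤ Tsum d (k + 1) ℓ * (G k - G ℓ) := by
  have := increment_le_average h1 h3 hℓ hk.le
  rw [Tsum_succ hℓ]
  linarith

theorem stored_increment_le
    (h1 : ∀ k < d, G (k + 1) - G k ≤ (d - k) * (Z k - G k))
    (h2 : ∀ k < d, Q (k + 1) ≤ Q k + G (k + 1) - Z k)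
    (h3 : ∀ k < d, G (k + 2) ≤ 2 * G (k + 1) - Z k) {k : ℕ} (hℓ : ℓ ≤ k) (hk : k < d) :
    Tsum d (k + 1) ℓ * (Q (k + 1) - Q k) ≤ (d - (k + 1)) * (G (k + 1) - G ℓ) := by
  have a := increment_le_average h1 h3 hℓ hk.le
  have hk1 : (k : ℝ) + 1 ≤ d := by exact_mod_cast hk
  have hpos : (0 : ℝ) < d - k := by linarith
  have hT := Tsum_nonneg (d := d) (k := k + 1) (ℓ := ℓ) (by omega)
  have hstep : (d - k) * (Q (k + 1) - Q k) ≤ (d - (k + 1)) * (G (k + 1) - G k) := by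
    have := mul_le_mul_of_nonneg_left (h2 k hk) hpos.le
    linarith [h1 k hk]
  refine le_of_mul_le_mul_left ?_ hpos
  have b := mul_le_mul_of_nonneg_left hstep hT
  have c := mul_le_mul_of_nonneg_left a (show (0 : ℝ) ≤ d - (k + 1) by linarith)
  rw [Tsum_succ hℓ] at b ⊢
  nlinarith

theorem normalized_increment_le
    (h1 : ∀ k < d, G (k + 1) - G k ≤ (d - k) * (Z k - G k))
    (h3 : ∀ k < d, G (k + 2) ≤ 2 * G (k + 1) - Z k) {k m : ℕ} (hkm : k ≤ m) (hm : m < d) :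
    (G (m + 1) - G m) / (d - m) ≤ (G (k + 1) - G k) / (d - k) := by
  induction m, hkm using Nat.le_induction with
  | base => exact le_rfl
  | succ m hkm ih =>
    refine le_trans ?_ (ih (by omega))
    have hm1 : (m : ℝ) + 1 < d := by exact_mod_cast hm
    have hd := increment_decay h1 h3 (k := m) (by omega)
    push_cast
    rw [div_le_div_iff₀ (by linarith) (by linarith)]
    linarith

/-- `Q - G` is the entropy of the next node given the repair data. Each step lowers it by at least
`Z k - G k`, hence by the normalized increment at `k`, which is no smaller than the one at `ℓ`. -/
theorem stored_cond_le
    (h1 : ∀ k < d, G (k + 1) - G k ≤ (d - k) * (Z k - G k))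
    (h2 : ∀ k < d, Q (k + 1) ≤ Q k + G (k + 1) - Z k)
    (h3 : ∀ k < d, G (k + 2) ≤ 2 * G (k + 1) - Z k) (hd : ℓ < d) {k : ℕ} (hk : k ≤ ℓ) :
    Q k - G k ≤ Q 0 - G 0 - k * ((G (ℓ + 1) - G ℓ) / (d - ℓ)) := by
  induction k with
  | zero => simp
  | succ k ih =>
    have ih := ih (by omega)
    have a := h2 k (by omega)
    have b := normalized_increment_le h1 h3 (k := k) (m := ℓ) (by omega) hd
    have hk1 : (k : ℝ) < d := by exact_mod_cast (show k < d by omega)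
    have c : (G (k + 1) - G k) / (d - k) ≤ Z k - G k := by
      rw [div_le_iff₀ (by linarith)]
      linarith [h1 k (by omega)]
    push_cast
    linarith

end SingleLevel

/-! ### Chaining the levels -/

section MultiLevel

variable {d ℓ : ℕ} {G Q Z : ℕ → ℕ → ℝ} {b : ℕ → ℝ} {α β : ℝ}

theorem rate_sum_le_increment (hd : ℓ < d)
    (h1 : ∀ j k, k < d → G j (k + 1) - G j k ≤ (d - k) * (Z j k - G j k))
    (h3 : ∀ j k, k < d → G j (k + 2) ≤ 2 * G j (k + 1) - Z j k)
    (h4 : ∀ j, ℓ ≤ j → j < d → G j (j + 1) = G (j + 1) (j + 1))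
    (h5 : ∀ j, ℓ ≤ j → j < d → G (j + 1) ℓ = G j ℓ + b (j + 1))
    (h6 : G d ℓ ≤ G d d) :
    ∑ j ∈ Icc (ℓ + 1) d, (Tsum d j ℓ)⁻¹ * b j ≤ (G ℓ (ℓ + 1) - G ℓ ℓ) / (d - ℓ) := by
  have key : ∀ k, ℓ ≤ k → k < d → ∑ j ∈ Icc (ℓ + 1) (k + 1), (Tsum d j ℓ)⁻¹ * b j +
      (G (k + 1) (k + 1) - G (k + 1) ℓ) / Tsum d (k + 1) ℓ ≤
      (G ℓ (ℓ + 1) - G ℓ ℓ) / (d - ℓ) := by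
    intro k hk
    induction k, hk using Nat.le_induction with
    | base =>
      intro _
      simp only [Icc_self, sum_singleton]
      rw [Tsum_succ le_rfl, Tsum_self, zero_add, h4 ℓ le_rfl hd, h5 ℓ le_rfl hd]
      apply le_of_eq
      ring
    | succ k hk ih =>
      intro hkd
      refine le_trans ?_ (ih (by omega))
      rw [sum_Icc_succ_top (by omega), add_assoc]
      have := average_anti (ℓ := ℓ) (h1 (k + 1)) (h3 (k + 1)) (k := k + 1) (by omega) hkd
      rw [h4 (k + 1) (by omega) hkd] at this
      have hT1 := Tsum_pos (d := d) (k := k + 1) (ℓ := ℓ) (by omega) (by omega)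
      have hT2 := Tsum_pos (d := d) (k := k + 1 + 1) (ℓ := ℓ) (by omega) (by omega)
      have h5' := h5 (k + 1) (by omega) hkd
      gcongr
      rw [le_div_iff₀ hT1, ← mul_le_mul_iff_right₀ hT2]
      refine le_trans (le_of_eq ?_) this
      rw [h5']
      field_simp
      ring
  have := key (d - 1) (by omega) (by omega)
  rw [show d - 1 + 1 = d by omega] at this
  have hnn : 0 ≤ (G d d - G d ℓ) / Tsum d d ℓ :=
    div_nonneg (by linarith) (Tsum_nonneg le_rfl)
  linarith

/-- The potential is `(C / Tsum - 1) (G - G ℓ) + (Q - G ℓ)` with `C = (d - ℓ)(d + 1)`. The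
coefficients add up to `C / Tsum`, so a new message of entropy `b` releases exactly `C b / Tsum`. At
`k = ℓ` one has `Tsum = d - ℓ` and the first coefficient is `d`, which gives the right-hand side;
`Tsum_le` keeps the coefficient nonnegative. -/
theorem rate_sum_le_combined (hd : ℓ < d)
    (h1 : ∀ j k, k < d → G j (k + 1) - G j k ≤ (d - k) * (Z j k - G j k))
    (h2 : ∀ j k, k < d → Q j (k + 1) ≤ Q j k + G j (k + 1) - Z j k)
    (h3 : ∀ j k, k < d → G j (k + 2) ≤ 2 * G j (k + 1) - Z j k)
    (h4 : ∀ j, ℓ ≤ j → j < d → G j (j + 1) = G (j + 1) (j + 1))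
    (h4' : ∀ j, ℓ ≤ j → j < d → Q j j = Q (j + 1) j)
    (h5 : ∀ j, ℓ ≤ j → j < d → G (j + 1) ℓ = G j ℓ + b (j + 1))
    (h6 : G d ℓ ≤ G d d) (h7 : G d ℓ ≤ Q d (d - 1)) :
    (d - ℓ) * (d + 1) * ∑ j ∈ Icc (ℓ + 1) d, (Tsum d j ℓ)⁻¹ * b j ≤
      d * (G ℓ (ℓ + 1) - G ℓ ℓ) + (Q ℓ ℓ - G ℓ ℓ) := by
  have hdℓ : (ℓ : ℝ) < d := by exact_mod_cast hd
  have key : ∀ k, ℓ ≤ k → k < d →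
      (d - ℓ) * (d + 1) * ∑ j ∈ Icc (ℓ + 1) (k + 1), (Tsum d j ℓ)⁻¹ * b j +
      (((d - ℓ) * (d + 1) / Tsum d (k + 1) ℓ - 1) * (G (k + 1) (k + 1) - G (k + 1) ℓ) +
        (Q (k + 1) k - G (k + 1) ℓ)) ≤
      d * (G ℓ (ℓ + 1) - G ℓ ℓ) + (Q ℓ ℓ - G ℓ ℓ) := by
    intro k hk
    induction k, hk using Nat.le_induction with
    | base =>
      intro _
      simp only [Icc_self, sum_singleton]
      rw [Tsum_succ le_rfl, Tsum_self, zero_add, h4 ℓ le_rfl hd, h5 ℓ le_rfl hd, h4' ℓ le_rfl hd]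
      apply le_of_eq
      have : (d : ℝ) - ℓ ≠ 0 := by linarith
      field_simp
      ring
    | succ k hk ih =>
      intro hkd
      refine le_trans ?_ (ih (by omega))
      rw [sum_Icc_succ_top (by omega), mul_add, add_assoc]
      have e1 := average_anti (ℓ := ℓ) (h1 (k + 1)) (h3 (k + 1)) (k := k + 1) (by omega) hkd
      have e2 := stored_increment_le (ℓ := ℓ) (h1 (k + 1)) (h2 (k + 1)) (h3 (k + 1)) (k := k)
        (by omega) (by omega)
      have e3 := h4 (k + 1) (by omega) hkd
      have e4 := h4' (k + 1) (by omega) hkd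
      have e5 := h5 (k + 1) (by omega) hkd
      have hT1 := Tsum_pos (d := d) (k := k + 1) (ℓ := ℓ) (by omega) (by omega)
      have hT2 := Tsum_pos (d := d) (k := k + 1 + 1) (ℓ := ℓ) (by omega) (by omega)
      have hle := Tsum_le (d := d) (k := k + 1 + 1) (ℓ := ℓ) (by omega) (by omega)
      have hs := Tsum_succ (d := d) (k := k + 1) (ℓ := ℓ) (by omega)
      push_cast at hs
      rw [← e3, ← e4, e5]
      refine add_le_add le_rfl ?_
      set T1 := Tsum d (k + 1) ℓ
      set T2 := Tsum d (k + 1 + 1) ℓ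
      set C : ℝ := (d - ℓ) * (d + 1)
      set E1 := G (k + 1) (k + 1) - G (k + 1) ℓ with hE1
      set E2 := G (k + 1) (k + 1 + 1) - G (k + 1) ℓ with hE2
      have f1 : (C / T2 - 1) * E2 ≤ (C / T2 - 1) * (T2 / T1 * E1) := by
        refine mul_le_mul_of_nonneg_left ?_ ?_
        · rw [div_mul_eq_mul_div, le_div_iff₀ hT1]
          linarith
        · rw [sub_nonneg, le_div_iff₀ hT2]
          simp only [C]
          linarith
      have f2 : Q (k + 1) (k + 1) - Q (k + 1) k ≤ (T2 - T1) / T1 * E1 := by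
        rw [div_mul_eq_mul_div, le_div_iff₀ hT1, hs]
        linarith
      -- The slack in replacing `T1` by `T2` is exactly what pays for the growth of `Q` in `f2`.
      have f3 : (C / T2 - 1) * (T2 / T1 * E1) = (C / T1 - 1) * E1 - (T2 - T1) / T1 * E1 := by
        field_simp
        ring
      have f4 : C * (T2⁻¹ * b (k + 1 + 1)) = C / T2 * b (k + 1 + 1) := by
        field_simp
      rw [f4, show G (k + 1) (k + 1 + 1) - (G (k + 1) ℓ + b (k + 1 + 1)) = E2 - b (k + 1 + 1) by
        rw [hE2]; ring]
      linarith
  have := key (d - 1) (by omega) (by omega)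
  rw [show d - 1 + 1 = d by omega] at this
  have hnn : 0 ≤ ((d - ℓ) * (d + 1) / Tsum d d ℓ - 1) * (G d d - G d ℓ) := by
    refine mul_nonneg ?_ (by linarith)
    rw [sub_nonneg, le_div_iff₀ (Tsum_pos le_rfl hd)]
    have := Tsum_le (d := d) (k := d) (ℓ := ℓ) hd.le le_rfl
    linarith
  linarith

/-- The two outer bounds, from the inequalities between averaged entropies. -/
theorem outer_bounds_of_averages (hd : ℓ < d)
    (h1 : ∀ j k, k < d → G j (k + 1) - G j k ≤ (d - k) * (Z j k - G j k))
    (h2 : ∀ j k, k < d → Q j (k + 1) ≤ Q j k + G j (k + 1) - Z j k)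
    (h3 : ∀ j k, k < d → G j (k + 2) ≤ 2 * G j (k + 1) - Z j k)
    (h4 : ∀ j, ℓ ≤ j → j < d → G j (j + 1) = G (j + 1) (j + 1))
    (h4' : ∀ j, ℓ ≤ j → j < d → Q j j = Q (j + 1) j)
    (h5 : ∀ j, ℓ ≤ j → j < d → G (j + 1) ℓ = G j ℓ + b (j + 1))
    (h6 : G d ℓ ≤ G d d) (h7 : G d ℓ ≤ Q d (d - 1))
    (hβ : Z ℓ ℓ ≤ G ℓ ℓ + β) (hα : Q ℓ 0 - G ℓ 0 ≤ α) :
    ∑ j ∈ Icc (ℓ + 1) d, (Tsum d j ℓ)⁻¹ * b j ≤ β ∧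
    (d - ℓ) * (d + 1) * ∑ j ∈ Icc (ℓ + 1) d, (Tsum d j ℓ)⁻¹ * b j ≤
      α + (d * (d - ℓ) - ℓ) * β := by
  have hdℓ : (ℓ : ℝ) + 1 ≤ d := by exact_mod_cast hd
  have hs : (G ℓ (ℓ + 1) - G ℓ ℓ) / (d - ℓ) ≤ β := by
    rw [div_le_iff₀ (by linarith)]
    have := mul_le_mul_of_nonneg_left hβ (show (0 : ℝ) ≤ d - ℓ by linarith)
    linarith [h1 ℓ ℓ hd]
  refine ⟨(rate_sum_le_increment hd h1 h3 h4 h5 h6).trans hs, ?_⟩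
  refine (rate_sum_le_combined hd h1 h2 h3 h4 h4' h5 h6 h7).trans ?_
  have a := stored_cond_le (h1 ℓ) (h2 ℓ) (h3 ℓ) hd le_rfl
  have hc : (0 : ℝ) ≤ d * (d - ℓ) - ℓ := by
    have : (d : ℝ) * 1 ≤ d * (d - ℓ) := mul_le_mul_of_nonneg_left (by linarith) (by positivity)
    -- The case `d ≥ ℓ + 1` makes `d (d - ℓ) - ℓ` nonnegative; this is the coefficient left after
    -- `stored_cond_le` subtracts `ℓ` increments, and it allows replacing the increment by `β`.
    linarith
  have e := mul_le_mul_of_nonneg_left hs hc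
  have f : G ℓ (ℓ + 1) - G ℓ ℓ = (d - ℓ) * ((G ℓ (ℓ + 1) - G ℓ ℓ) / (d - ℓ)) := by
    have : (d : ℝ) - ℓ ≠ 0 := by linarith
    field_simp
  set s := (G ℓ (ℓ + 1) - G ℓ ℓ) / (d - ℓ)
  rw [f]
  linarith

end MultiLevel

end MDCSR

namespace MDCSR

open Finset

/-! ### Averaging over the orderings of `d + 1` nodes -/

section Repair

variable {Ω : Type} [Fintype Ω] {d : ℕ} (w : Fin (d + 1) → Setoid Ω)
  (s : Fin (d + 1) → Fin (d + 1) → Setoid Ω)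

/-- The partition generated by all the data downloaded to repair the nodes in `A`. -/
noncomputable def repairPart (A : Finset (Fin (d + 1))) : Setoid Ω :=
  A.inf fun x => univ.inf fun y => s y x

/-- The nodes in the first `k` positions of an ordering of the nodes. -/
def firstNodes (π : Equiv.Perm (Fin (d + 1))) (k : ℕ) : Finset (Fin (d + 1)) :=
  {v | (π.symm v : ℕ) < k}

theorem mem_firstNodes {π : Equiv.Perm (Fin (d + 1))} {k : ℕ} {v : Fin (d + 1)} :
    v ∈ firstNodes π k ↔ (π.symm v : ℕ) < k := by simp [firstNodes]

theorem firstNodes_zero (π : Equiv.Perm (Fin (d + 1))) : firstNodes π 0 = ∅ := by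
  ext; simp [mem_firstNodes]

theorem firstNodes_mono (π : Equiv.Perm (Fin (d + 1))) {k m : ℕ} (h : k ≤ m) :
    firstNodes π k ⊆ firstNodes π m := fun v hv => by
  rw [mem_firstNodes] at hv ⊢
  omega

theorem firstNodes_succ (π : Equiv.Perm (Fin (d + 1))) (k : Fin (d + 1)) :
    firstNodes π (k + 1) = insert (π k) (firstNodes π k) := by
  ext v
  rw [mem_insert, mem_firstNodes, mem_firstNodes, ← Equiv.symm_apply_eq, Fin.ext_iff]
  omega

theorem firstNodes_mul_swap (π : Equiv.Perm (Fin (d + 1))) {k : ℕ} {a b : Fin (d + 1)}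
    (ha : k ≤ a) (hb : k ≤ b) : firstNodes (π * Equiv.swap a b) k = firstNodes π k := by
  ext v
  rw [mem_firstNodes, mem_firstNodes]
  have h : (π * Equiv.swap a b).symm v = Equiv.swap a b (π.symm v) := by
    rw [Equiv.symm_apply_eq]
    simp
  rw [h, Equiv.swap_apply_def]
  split_ifs with h1 h2
  · rw [h1]; omega
  · rw [h2]; omega
  · rfl

theorem card_firstNodes (π : Equiv.Perm (Fin (d + 1))) {k : ℕ} (hk : k ≤ d + 1) :
    #(firstNodes π k) = k := by
  induction k with
  | zero => rw [firstNodes_zero, card_empty]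
  | succ k ih =>
    have := firstNodes_succ π ⟨k, by omega⟩
    simp only at this
    rw [this, card_insert_of_notMem, ih (by omega)]
    simp [mem_firstNodes]

omit [Fintype Ω] in
theorem repairPart_insert (A : Finset (Fin (d + 1))) (x : Fin (d + 1)) :
    repairPart s (insert x A) = (univ.inf fun y => s y x) ⊓ repairPart s A := by
  rw [repairPart, inf_insert, repairPart]

omit [Fintype Ω] in
theorem repairPart_anti {A A' : Finset (Fin (d + 1))} (h : A ⊆ A') :
    repairPart s A' ≤ repairPart s A := inf_mono h

variable {w s}

omit [Fintype Ω] in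
theorem repairPart_le_download {A : Finset (Fin (d + 1))} {x : Fin (d + 1)} (hx : x ∈ A)
    (y : Fin (d + 1)) : repairPart s A ≤ s y x :=
  (inf_le hx).trans (inf_le (mem_univ y))

omit [Fintype Ω] in
theorem repairPart_le_stored (hs : ∀ x, (univ.inf fun y => s y x) ≤ w x)
    {A : Finset (Fin (d + 1))} {x : Fin (d + 1)} (hx : x ∈ A) : repairPart s A ≤ w x :=
  (inf_le hx).trans (hs x)

variable (w s)

/-- The sum over all orderings of the entropy of the repair data of the first `k` nodes, joint
with `M`. -/
noncomputable def repairSum (M : Setoid Ω) (k : ℕ) : ℝ :=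
  ∑ π : Equiv.Perm (Fin (d + 1)), partEntropy (repairPart s (firstNodes π k) ⊓ M)

/-- The sum over all orderings of the entropy of the repair data of the first `k` nodes and the
content of the next node, joint with `M`. -/
noncomputable def storedSum (M : Setoid Ω) (k : ℕ) : ℝ :=
  ∑ π : Equiv.Perm (Fin (d + 1)),
    partEntropy (repairPart s (firstNodes π k) ⊓ w (π (Fin.ofNat _ k)) ⊓ M)

/-- The sum over all orderings of the entropy of the repair data of the first `k` nodes and one
download to the next node, joint with `M`. -/
noncomputable def downloadSum (M : Setoid Ω) (k : ℕ) : ℝ :=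
  ∑ π : Equiv.Perm (Fin (d + 1)), partEntropy
    (repairPart s (firstNodes π k) ⊓ s (π (Fin.ofNat _ (k + 1))) (π (Fin.ofNat _ k)) ⊓ M)

variable {w s}

theorem sum_perm_mul_swap {R : Type*} [AddCommMonoid R] (a b : Fin (d + 1))
    (f : Equiv.Perm (Fin (d + 1)) → R) : ∑ π, f (π * Equiv.swap a b) = ∑ π, f π :=
  Fintype.sum_equiv (Equiv.mulRight (Equiv.swap a b)) _ _ fun _ => rfl

/-- When the node in position `k` is repaired, downloads from earlier nodes are already known, since
their repair data determine their contents. Only the `d - k` later helpers contribute, and after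
averaging all contribute equally. -/
theorem repairSum_succ_sub_le (hw : ∀ x y, w y ≤ s y x)
    (hs : ∀ x, (univ.inf fun y => s y x) ≤ w x) (hself : ∀ x, s x x = ⊤) (M : Setoid Ω) {k : ℕ}
    (hk : k < d) :
    repairSum s M (k + 1) - repairSum s M k ≤
      (d - k) * (downloadSum s M k - repairSum s M k) := by
  classical
  set x : Fin (d + 1) := ⟨k, by omega⟩ with hx
  set y₀ : Fin (d + 1) := ⟨k + 1, by omega⟩ with hy₀
  have hxk : Fin.ofNat (d + 1) k = x := by ext; simp [hx]; omega
  have hyk : Fin.ofNat (d + 1) (k + 1) = y₀ := by ext; simp [hy₀]; omega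
  have hZ : ∀ y ∈ Ioi x, ∑ π : Equiv.Perm (Fin (d + 1)),
      (partEntropy (repairPart s (firstNodes π k) ⊓ M ⊓ s (π y) (π x)) -
        partEntropy (repairPart s (firstNodes π k) ⊓ M)) =
      downloadSum s M k - repairSum s M k := by
    intro y hy
    have hy : k < (y : ℕ) := by simpa [hx, Fin.lt_def] using hy
    rw [sum_sub_distrib, ← repairSum]
    congr 1
    -- Reindexing by a swap of two later positions fixes the first `k` nodes and position `k`, so
    -- any later helper may be taken in position `k + 1`.
    rw [← sum_perm_mul_swap y₀ y, downloadSum]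
    refine sum_congr rfl fun π _ => ?_
    have hxy : Equiv.swap y₀ y x = x := by
      apply Equiv.swap_apply_of_ne_of_ne
      · simp [hx, hy₀]
      · rw [Ne, Fin.ext_iff]
        simp only [hx]
        omega
    rw [firstNodes_mul_swap π (by simp [hy₀]) hy.le, hxk, hyk, Equiv.Perm.mul_apply,
      Equiv.Perm.mul_apply, Equiv.swap_apply_right, hxy, inf_right_comm]
  have hcard : (#(Ioi x) : ℝ) = d - k := by
    rw [Fin.card_Ioi]
    simp only [hx]
    rw [Nat.cast_sub (by omega), Nat.cast_sub (by omega)]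
    push_cast
    ring
  rw [← hcard, ← nsmul_eq_mul, ← sum_const, ← sum_congr rfl hZ, sum_comm, repairSum, repairSum,
    ← sum_sub_distrib]
  refine sum_le_sum fun π _ => ?_
  refine le_trans (sub_le_sub_right (partEntropy_anti ?_) _)
    (partEntropy_inf_finset_inf_le (Ioi x) (repairPart s (firstNodes π k) ⊓ M)
      fun y => s (π y) (π x))
  rw [show firstNodes π (k + 1) = insert (π x) (firstNodes π k) from firstNodes_succ π x,
    repairPart_insert]
  refine le_inf (le_inf (Finset.le_inf fun v _ => ?_) (inf_le_left.trans inf_le_left))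
    (inf_le_left.trans inf_le_right)
  obtain ⟨y, rfl⟩ := π.surjective v
  rcases lt_trichotomy x y with h | rfl | h
  · exact inf_le_right.trans (Finset.inf_le (f := fun y => s (π y) (π x)) (mem_Ioi.2 h))
  · rw [hself]
    exact le_top
  · refine (inf_le_left.trans inf_le_left).trans ((repairPart_le_stored hs ?_).trans (hw _ _))
    rw [mem_firstNodes, Equiv.symm_apply_apply]
    exact h

/-- Submodularity for the content of the node in position `k + 1` and the repair data of the node in
position `k`, given the first `k`: both determine the download from the former to the latter. -/
theorem storedSum_succ_le (hw : ∀ x y, w y ≤ s y x) (M : Setoid Ω) {k : ℕ}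
    (hk : k < d) :
    storedSum w s M (k + 1) ≤ storedSum w s M k + repairSum s M (k + 1) - downloadSum s M k := by
  set x : Fin (d + 1) := ⟨k, by omega⟩ with hx
  set y : Fin (d + 1) := ⟨k + 1, by omega⟩ with hy
  have hxk : Fin.ofNat (d + 1) k = x := by ext; simp [hx]; omega
  have hyk : Fin.ofNat (d + 1) (k + 1) = y := by ext; simp [hy]; omega
  have hQ : storedSum w s M k = ∑ π : Equiv.Perm (Fin (d + 1)),
      partEntropy (repairPart s (firstNodes π k) ⊓ w (π y) ⊓ M) := by
    rw [storedSum, ← sum_perm_mul_swap x y]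
    refine sum_congr rfl fun π _ => ?_
    rw [firstNodes_mul_swap π (by simp [hx]) (by simp [hy]), hxk, Equiv.Perm.mul_apply,
      Equiv.swap_apply_left]
  rw [le_sub_iff_add_le, hQ, storedSum, repairSum, downloadSum, ← sum_add_distrib,
    ← sum_add_distrib]
  refine sum_le_sum fun π _ => ?_
  rw [hxk, hyk]
  have hsucc : repairPart s (firstNodes π (k + 1)) =
      (univ.inf fun y => s y (π x)) ⊓ repairPart s (firstNodes π k) := by
    rw [← repairPart_insert, ← firstNodes_succ π x]
  have hmono := repairPart_anti s (firstNodes_mono π (Nat.le_add_right k 1))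
  refine le_trans (add_le_add (partEntropy_anti ?_) le_rfl) (partEntropy_submodular
    (r := repairPart s (firstNodes π k) ⊓ w (π y) ⊓ M)
    (s := repairPart s (firstNodes π (k + 1)) ⊓ M) ?_ ?_)
  · exact le_inf (inf_le_right.trans inf_le_left |> fun h => le_inf h
      (inf_le_left.trans (inf_le_left.trans inf_le_right))) (inf_le_right.trans inf_le_right)
  · exact inf_le_inf (inf_le_inf le_rfl (hw _ _)) le_rfl
  · refine inf_le_inf (le_inf hmono ?_) le_rfl
    rw [hsucc]
    exact inf_le_left.trans (Finset.inf_le (mem_univ _))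

/-- Submodularity for the repair data of two nodes `x`, `y` added to the first `k`. The download
from `y` to `x` is common to both: it is part of the repair of `x`, and a function of the content of
`y`. -/
theorem repairSum_add_two_le (hw : ∀ x y, w y ≤ s y x)
    (hs : ∀ x, (univ.inf fun y => s y x) ≤ w x) (M : Setoid Ω) {k : ℕ} (hk : k < d) :
    repairSum s M (k + 2) ≤ 2 * repairSum s M (k + 1) - downloadSum s M k := by
  set x : Fin (d + 1) := ⟨k, by omega⟩ with hx
  set y : Fin (d + 1) := ⟨k + 1, by omega⟩ with hy
  have hxk : Fin.ofNat (d + 1) k = x := by ext; simp [hx]; omega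
  have hyk : Fin.ofNat (d + 1) (k + 1) = y := by ext; simp [hy]; omega
  have hx1 (π : Equiv.Perm (Fin (d + 1))) :
      firstNodes π (k + 1) = insert (π x) (firstNodes π k) := firstNodes_succ π x
  have hy1 (π : Equiv.Perm (Fin (d + 1))) :
      firstNodes π (k + 2) = insert (π y) (firstNodes π (k + 1)) := firstNodes_succ π y
  have hG : repairSum s M (k + 1) = ∑ π : Equiv.Perm (Fin (d + 1)),
      partEntropy (repairPart s (insert (π y) (firstNodes π k)) ⊓ M) := by
    rw [repairSum, ← sum_perm_mul_swap x y]
    refine sum_congr rfl fun π _ => ?_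
    rw [hx1, firstNodes_mul_swap π (by simp [hx]) (by simp [hy]), Equiv.Perm.mul_apply,
      Equiv.swap_apply_left]
  rw [le_sub_iff_add_le, two_mul]
  nth_rewrite 2 [hG]
  rw [repairSum, repairSum, downloadSum, ← sum_add_distrib, ← sum_add_distrib]
  refine sum_le_sum fun π _ => ?_
  rw [hxk, hyk]
  refine le_trans (add_le_add (partEntropy_anti ?_) le_rfl) (partEntropy_submodular
    (r := repairPart s (firstNodes π (k + 1)) ⊓ M)
    (s := repairPart s (insert (π y) (firstNodes π k)) ⊓ M) ?_ ?_)
  · rw [hy1, repairPart_insert, repairPart_insert]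
    exact le_inf (le_inf (inf_le_right.trans (inf_le_left.trans inf_le_left))
      (inf_le_left.trans inf_le_left)) (inf_le_left.trans inf_le_right)
  · refine inf_le_inf (le_inf ?_ ?_) le_rfl
    · exact repairPart_anti s (firstNodes_mono π (Nat.le_add_right k 1))
    · exact repairPart_le_download (by rw [hx1]; exact mem_insert_self _ _) _
  · refine inf_le_inf (le_inf ?_ ?_) le_rfl
    · exact repairPart_anti s (subset_insert _ _)
    · exact (repairPart_le_stored hs (mem_insert_self _ _)).trans (hw _ _)

end Repair

/-! ### Outer bounds for abstract repair systems -/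

section OuterBounds

variable {Ω : Type} [Fintype Ω] {d ℓ : ℕ} {w : Fin (d + 1) → Setoid Ω}
  {s : Fin (d + 1) → Fin (d + 1) → Setoid Ω} {M : ℕ → Setoid Ω} {b : ℕ → ℝ} {α β : ℝ}

theorem outer_bounds_of_partitions (hd : ℓ < d) (hw : ∀ x y, w y ≤ s y x)
    (hs : ∀ x, (univ.inf fun y => s y x) ≤ w x) (hself : ∀ x, s x x = ⊤)
    (hMtop : M ℓ = ⊤) (hMsucc : ∀ j, M (j + 1) ≤ M j)
    (hdec : ∀ j, ℓ ≤ j → j < d → ∀ A : Finset (Fin (d + 1)), #A = j + 1 →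
      A.inf w ⊓ M j ≤ M (j + 1))
    (hsec : ∀ j, ℓ ≤ j → j < d → ∀ A : Finset (Fin (d + 1)), #A = ℓ →
      partEntropy (repairPart s A ⊓ M (j + 1)) = partEntropy (repairPart s A ⊓ M j) + b (j + 1))
    (hα : ∀ x, partEntropy (w x) ≤ α) (hβ : ∀ x y, partEntropy (s y x) ≤ β) :
    ∑ j ∈ Icc (ℓ + 1) d, (Tsum d j ℓ)⁻¹ * b j ≤ β ∧
    (d - ℓ) * (d + 1) * ∑ j ∈ Icc (ℓ + 1) d, (Tsum d j ℓ)⁻¹ * b j ≤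
      α + (d * (d - ℓ) - ℓ) * β := by
  -- The sums over orderings are not normalized, so `b`, `α` and `β` all carry the factor `F`,
  -- cancelled at the end.
  set F : ℝ := (Fintype.card (Equiv.Perm (Fin (d + 1))) : ℝ) with hF
  have hFpos : 0 < F := by rw [hF]; exact_mod_cast Fintype.card_pos
  have hconst (c : ℝ) : ∑ _π : Equiv.Perm (Fin (d + 1)), c = F * c := by
    rw [sum_const, nsmul_eq_mul, Finset.card_univ]
  have key := outer_bounds_of_averages (ℓ := ℓ) (G := fun j => repairSum s (M j))
    (Q := fun j => storedSum w s (M j)) (Z := fun j => downloadSum s (M j))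
    (b := fun j => F * b j) (α := F * α) (β := F * β) hd
    (fun j k hk => repairSum_succ_sub_le hw hs hself (M j) hk)
    (fun j k hk => storedSum_succ_le hw (M j) hk)
    (fun j k hk => repairSum_add_two_le hw hs (M j) hk)
    (by
      intro j hj hjd
      refine sum_congr rfl fun π _ => congrArg partEntropy (le_antisymm ?_ ?_)
      · refine le_inf inf_le_left ((inf_le_inf ?_ le_rfl).trans
          (hdec j hj hjd _ (card_firstNodes π (by omega))))
        exact Finset.le_inf fun x hx => repairPart_le_stored hs hx
      · exact inf_le_inf le_rfl (hMsucc j))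
    (by
      intro j hj hjd
      refine sum_congr rfl fun π _ => congrArg partEntropy (le_antisymm ?_ ?_)
      · refine le_inf inf_le_left ((inf_le_inf ?_ le_rfl).trans
          (hdec j hj hjd _ (card_firstNodes π (by omega))))
        have := firstNodes_succ π ⟨j, by omega⟩
        simp only at this
        rw [this, inf_insert]
        refine le_inf ?_ ?_
        · refine inf_le_right.trans (le_of_eq ?_)
          congr 2
          ext
          simp
          omega
        · exact inf_le_left.trans (Finset.le_inf fun x hx => repairPart_le_stored hs hx)
      · exact inf_le_inf le_rfl (hMsucc j))
    (by
      intro j hj hjd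
      simp only [repairSum]
      rw [← hconst, ← sum_add_distrib]
      exact sum_congr rfl fun π _ => hsec j hj hjd _ (card_firstNodes π (by omega)))
    (by
      refine sum_le_sum fun π _ => partEntropy_anti (inf_le_inf ?_ le_rfl)
      exact repairPart_anti s (firstNodes_mono π hd.le))
    (by
      refine sum_le_sum fun π _ => partEntropy_anti (inf_le_inf ?_ le_rfl)
      exact inf_le_left.trans (repairPart_anti s (firstNodes_mono π (by omega))))
    (by
      simp only [downloadSum, repairSum]
      rw [← hconst, ← sum_add_distrib]
      refine sum_le_sum fun π _ => ?_
      rw [inf_right_comm]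
      exact (partEntropy_inf_le _ _).trans (add_le_add le_rfl (hβ _ _)))
    (by
      simp only [storedSum, repairSum]
      rw [← hconst, ← sum_sub_distrib]
      refine sum_le_sum fun π _ => ?_
      simp [firstNodes_zero, repairPart, hMtop, partEntropy_top, hα])
  have hsum : ∑ j ∈ Icc (ℓ + 1) d, (Tsum d j ℓ)⁻¹ * (F * b j) =
      F * ∑ j ∈ Icc (ℓ + 1) d, (Tsum d j ℓ)⁻¹ * b j := by
    rw [mul_sum]
    exact sum_congr rfl fun j _ => by ring
  rw [hsum] at key
  refine ⟨le_of_mul_le_mul_left key.1 hFpos, le_of_mul_le_mul_left ?_ hFpos⟩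
  linarith [key.2]

end OuterBounds

end MDCSR

namespace MDCSR

open Finset

/-! ### Outer bounds for codes, and passage to the closure -/

section Converse

theorem partEntropy_messages {d : ℕ} {N : Level 1 d → ℕ} {K : ℕ} (hN : ∀ j, 0 < N j) (hK : 0 < K)
    (J : Finset (Level 1 d)) :
    partEntropy (Setoid.ker fun (ω : Sample N K) (i : J) => ω.1 i.1) =
      ∑ i ∈ J, Real.log (N i) := by
  classical
  have hN' (i : Level 1 d) : (N i : ℝ) ≠ 0 := by exact_mod_cast (hN i).ne'
  have : ∀ i, Nonempty (Fin (N i)) := fun i => ⟨⟨0, hN i⟩⟩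
  have : Nonempty (Fin K) := ⟨⟨0, hK⟩⟩
  have hle (J : Finset (Level 1 d)) :
      partEntropy (Setoid.ker fun (ω : Sample N K) (i : J) => ω.1 i.1) ≤
        ∑ i ∈ J, Real.log (N i) := by
    refine (partEntropy_ker_le _).trans (le_of_eq ?_)
    rw [Fintype.card_pi]
    simp only [Fintype.card_fin]
    rw [Nat.cast_prod, Real.log_prod fun i _ => hN' _]
    exact sum_coe_sort J fun i => Real.log (N i)
  have hkey : partEntropy (Setoid.ker fun ω : Sample N K => ω.2) ≤ Real.log K := by
    simpa using partEntropy_ker_le fun ω : Sample N K => ω.2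
  -- Messages in `J`, the other messages and the key together determine the sample, and their
  -- alphabet bounds add up to its full entropy; hence each bound is attained.
  refine le_antisymm (hle J) ?_
  have hbot : (Setoid.ker fun (ω : Sample N K) (i : J) => ω.1 i.1) ⊓
      (Setoid.ker fun (ω : Sample N K) (i : (Jᶜ : Finset (Level 1 d))) => ω.1 i.1) ⊓
      (Setoid.ker fun ω : Sample N K => ω.2) ≤ ⊥ := by
    rintro ⟨m, κ⟩ ⟨m', κ'⟩ ⟨⟨h1, h2⟩, h3⟩
    refine Prod.ext (funext fun i => ?_) h3
    by_cases hi : i ∈ J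
    · exact congrFun h1 ⟨i, hi⟩
    · exact congrFun h2 ⟨i, mem_compl.2 hi⟩
  have h1 := partEntropy_anti hbot
  rw [partEntropy_bot] at h1
  have h2 := partEntropy_inf_le ((Setoid.ker fun (ω : Sample N K) (i : J) => ω.1 i.1) ⊓
      (Setoid.ker fun (ω : Sample N K) (i : (Jᶜ : Finset (Level 1 d))) => ω.1 i.1))
      (Setoid.ker fun ω : Sample N K => ω.2)
  have h3 := partEntropy_inf_le (Setoid.ker fun (ω : Sample N K) (i : J) => ω.1 i.1)
      (Setoid.ker fun (ω : Sample N K) (i : (Jᶜ : Finset (Level 1 d))) => ω.1 i.1)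
  have h4 := hle Jᶜ
  have h5 : Real.log (Fintype.card (Sample N K)) =
      ∑ i ∈ J, Real.log (N i) + ∑ i ∈ Jᶜ, Real.log (N i) + Real.log K := by
    rw [sum_add_sum_compl, Fintype.card_prod, Fintype.card_pi]
    simp only [Fintype.card_fin]
    push_cast
    rw [Real.log_mul (prod_ne_zero_iff.2 fun i _ => hN' i) (by exact_mod_cast hK.ne'),
      Real.log_prod fun i _ => hN' _]
  linarith

namespace Code

variable {n d : ℕ} {N : Level 1 d → ℕ} {K T S : ℕ}

/-- Among the first `d + 1` nodes, the repair group of a node is formed by all the others. -/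
def firstGroup (hd : d < n) (x : Fin (d + 1)) : RepairGroup n d (Fin.castLEEmb hd x) :=
  ⟨(univ.erase x).map (Fin.castLEEmb hd), by simp, by simp⟩

open scoped Classical in
/-- The partition by what `y` sends to repair `x`. -/
noncomputable def downloadPart (hd : d < n) (c : Code n d N K T S) (y x : Fin (d + 1)) :
    Setoid (Sample N K) :=
  -- A node sends nothing to itself; with `⊤` here, infima may run over all `d + 1` nodes.
  if h : y = x then ⊤ else
    Setoid.ker (c.download (Fin.castLEEmb hd x) (firstGroup hd x)
      ⟨Fin.castLEEmb hd y, mem_map_of_mem _ (mem_erase.2 ⟨h, mem_univ y⟩)⟩)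

theorem downloadPart_of_ne (hd : d < n) (c : Code n d N K T S) {y x : Fin (d + 1)} (h : y ≠ x) :
    c.downloadPart hd y x = Setoid.ker (c.download (Fin.castLEEmb hd x) (firstGroup hd x)
      ⟨Fin.castLEEmb hd y, mem_map_of_mem _ (mem_erase.2 ⟨h, mem_univ y⟩)⟩) :=
  dif_neg h

/-- The partition by what `x` stores. -/
def storedPart (hd : d < n) (c : Code n d N K T S) (x : Fin (d + 1)) : Setoid (Sample N K) :=
  Setoid.ker (c.stored (Fin.castLEEmb hd x))

/-- The partition by the messages of level at most `j`. -/
def messagePart (N : Level 1 d → ℕ) (K : ℕ) (j : ℕ) : Setoid (Sample N K) :=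
  Setoid.ker fun (ω : Sample N K) (i : ({i | i.1 ≤ j} : Finset (Level 1 d))) => ω.1 i.1

theorem messagePart_iff {j : ℕ} {ω ω' : Sample N K} :
    messagePart N K j ω ω' ↔ ∀ i : Level 1 d, i.1 ≤ j → ω.1 i = ω'.1 i := by
  rw [messagePart, Setoid.ker_def, funext_iff]
  exact ⟨fun h i hi => h ⟨i, by simpa using hi⟩, fun h i => h i.1 (by simpa using i.2)⟩

theorem storedPart_le_downloadPart (hd : d < n) (c : Code n d N K T S) (x y : Fin (d + 1)) :
    c.storedPart hd y ≤ c.downloadPart hd y x := by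
  unfold downloadPart
  split_ifs with h
  · exact le_top
  · intro ω ω' hω
    exact congrArg (c.repairEnc _ _ _) (show c.stored _ ω = c.stored _ ω' from hω)

theorem inf_downloadPart_le (hd : d < n) (c : Code n d N K T S) (hc : c.NodeRegeneration)
    (x : Fin (d + 1)) : (univ.inf fun y => c.downloadPart hd y x) ≤ c.storedPart hd x := by
  intro ω ω' hω
  change c.stored _ ω = c.stored _ ω'
  rw [← hc _ (firstGroup hd x) ω, ← hc _ (firstGroup hd x) ω']
  congr 1
  funext i
  obtain ⟨i, hi⟩ := i
  obtain ⟨y, hy, rfl⟩ := mem_map.1 hi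
  exact (Finset.inf_le (f := fun y => c.downloadPart hd y x) (mem_univ y)).trans
    (c.downloadPart_of_ne hd (mem_erase.1 hy).1).le hω

theorem inf_storedPart_le {ℓ : ℕ} (hd : d < n) (c : Code n d N K T S) (hc : c.MessageRecovery ℓ)
    {j : ℕ} (hj : ℓ ≤ j) (hjd : j < d) (A : Finset (Fin (d + 1))) (hA : #A = j + 1) :
    A.inf (c.storedPart hd) ⊓ messagePart N K j ≤ messagePart N K (j + 1) := by
  rintro ω ω' ⟨h1, h2⟩
  rw [messagePart_iff] at h2 ⊢
  rintro ⟨i, hi⟩ hij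
  rcases Nat.lt_or_ge j i with h | h
  · have hcard : #(A.map (Fin.castLEEmb hd)) = i := by
      rw [card_map]
      simp only at hij
      omega
    subst hcard
    have hmem : #(A.map (Fin.castLEEmb hd)) ∈ Icc (ℓ + 1) d := by
      rw [mem_Icc, card_map]
      omega
    rw [← hc _ hmem ω, ← hc _ hmem ω']
    congr 1
    funext i
    obtain ⟨i, hi⟩ := i
    obtain ⟨y, hy, rfl⟩ := mem_map.1 hi
    exact (Finset.inf_le (f := c.storedPart hd) hy) h1
  · exact h2 _ h

theorem messages_le_messagePart {ℓ : ℕ} (hN : ∀ j : Level 1 d, j.1 ≤ ℓ → N j = 1) (j : ℕ) :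
    (Setoid.ker fun (ω : Sample N K) (j : Level (ℓ + 1) d) => ω.1 j.incl) ≤
      messagePart N K j := by
  intro ω ω' h
  rw [messagePart_iff]
  intro i _
  by_cases hi : i.1 ≤ ℓ
  · have : Subsingleton (Fin (N i)) := by
      rw [hN i hi]
      infer_instance
    exact Subsingleton.elim _ _
  · exact congrFun h ⟨i.1, mem_Icc.2 ⟨by omega, (mem_Icc.1 i.2).2⟩⟩

theorem eavesdropped_le_repairPart (hd : d < n) (c : Code n d N K T S) (A : Finset (Fin (d + 1))) :
    Setoid.ker (c.eavesdropped (A.map (Fin.castLEEmb hd))) ≤ repairPart (c.downloadPart hd) A := by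
  intro ω ω' h
  refine (Finset.le_inf (a := Setoid.ker (c.eavesdropped (A.map (Fin.castLEEmb hd))))
    fun x hx => Finset.le_inf fun y _ => ?_) h
  unfold downloadPart
  split_ifs with hxy
  · exact le_top
  · intro ω ω' h
    exact congrFun (congrFun (congrFun h ⟨Fin.castLEEmb hd x, mem_map_of_mem _ hx⟩)
      (firstGroup hd x)) _

theorem outer_bounds {ℓ : ℕ} (hℓ : ℓ < d) (hd : d < n) (c : Code n d N K T S)
    (hN : ∀ j, 0 < N j) (hK : 0 < K) (hN1 : ∀ j : Level 1 d, j.1 ≤ ℓ → N j = 1)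
    (hrec : c.MessageRecovery ℓ) (hreg : c.NodeRegeneration) (hsec : c.RepairSecrecy ℓ) :
    rateSum d ℓ (fun j => Real.log (N j.incl)) ≤ Real.log S ∧
    ((d : ℝ) - ℓ) * (d + 1) * rateSum d ℓ (fun j => Real.log (N j.incl)) ≤
      Real.log T + (d * (d - ℓ) - ℓ) * Real.log S := by
  classical
  have : ∀ i, Nonempty (Fin (N i)) := fun i => ⟨⟨0, hN i⟩⟩
  have : Nonempty (Fin K) := ⟨⟨0, hK⟩⟩
  set b : ℕ → ℝ := fun i => if h : i ∈ Icc 1 d then Real.log (N ⟨i, h⟩) else 0 with hb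
  have hrate : rateSum d ℓ (fun j => Real.log (N j.incl)) =
      ∑ j ∈ Icc (ℓ + 1) d, (Tsum d j ℓ)⁻¹ * b j := by
    rw [rateSum, ← sum_coe_sort (Icc (ℓ + 1) d)]
    refine sum_congr rfl fun j _ => ?_
    rw [hb]
    simp only [dif_pos (mem_all j.2)]
    rfl
  rw [hrate]
  have hH (j : ℕ) (hj : ℓ ≤ j) (hjd : j < d) :
      partEntropy (messagePart N K (j + 1)) = partEntropy (messagePart N K j) + b (j + 1) := by
    have hmem : j + 1 ∈ Icc 1 d := mem_Icc.2 ⟨by omega, by omega⟩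
    rw [messagePart, messagePart, partEntropy_messages hN hK, partEntropy_messages hN hK, hb]
    simp only [dif_pos hmem]
    rw [show ({i | i.1 ≤ j + 1} : Finset (Level 1 d)) = insert ⟨j + 1, hmem⟩
      ({i | i.1 ≤ j} : Finset (Level 1 d)) by
        ext i
        simp only [mem_filter, mem_univ, true_and, mem_insert, Subtype.ext_iff]
        omega]
    rw [sum_insert (by simp), add_comm]
  refine outer_bounds_of_partitions (w := c.storedPart hd) (s := c.downloadPart hd)
    (M := messagePart N K) hℓ (c.storedPart_le_downloadPart hd) (c.inf_downloadPart_le hd hreg)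
    (fun x => by simp [downloadPart]) ?_ ?_
    (fun j hj hjd A hA => c.inf_storedPart_le hd hrec hj hjd A hA) ?_ ?_ ?_
  · refine top_le_iff.1 fun ω ω' _ => ?_
    rw [messagePart_iff]
    intro i hi
    have : Subsingleton (Fin (N i)) := by
      rw [hN1 i hi]
      infer_instance
    exact Subsingleton.elim _ _
  · intro j ω ω' h
    rw [messagePart_iff] at h ⊢
    exact fun i hi => h i (hi.trans (Nat.le_succ j))
  · intro j hj hjd A hA
    have hs := hsec (A.map (Fin.castLEEmb hd)) (by rw [card_map, hA])
    rw [mutualInfo_eq] at hs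
    have hind (j : ℕ) := partEntropy_inf_eq_of_le (messages_le_messagePart hN1 j)
      (c.eavesdropped_le_repairPart hd A) hs
    rw [inf_comm, hind, inf_comm, hind, hH j hj hjd]
    ring
  · intro x
    exact (partEntropy_ker_le (c.stored (Fin.castLEEmb hd x))).trans (by rw [Fintype.card_fin])
  · intro x y
    unfold downloadPart
    split_ifs with h
    · rw [partEntropy_top]
      exact Real.log_natCast_nonneg S
    · exact (partEntropy_ker_le _).trans (by rw [Fintype.card_fin])

end Code

theorem Achievable.outer_bounds {n d ℓ : ℕ} (hℓ : ℓ < d) (hd : d < n) {p : Tuple d ℓ}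
    (hp : Achievable n d ℓ p) :
    rateSum d ℓ p.1 ≤ p.2.2 ∧
    ((d : ℝ) - ℓ) * (d + 1) * rateSum d ℓ p.1 ≤ p.2.1 + (d * (d - ℓ) - ℓ) * p.2.2 := by
  obtain ⟨N, K, T, S, c, hN, hK, -, -, hN1, hpos, hα, hβ, hB, hrec, hreg, hsec⟩ := hp
  obtain ⟨h1, h2⟩ := c.outer_bounds hℓ hd hN hK hN1 hrec hreg hsec
  set σ := ∑ t : Level (ℓ + 1) d, Real.log (N t.incl)
  have hrate : rateSum d ℓ p.1 = rateSum d ℓ (fun j => Real.log (N j.incl)) / σ := by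
    rw [rateSum, rateSum, sum_div]
    exact sum_congr rfl fun j _ => by rw [← hB j, mul_div_assoc]
  rw [hrate, ← hα, ← hβ]
  constructor
  · gcongr
  · rw [← mul_div_assoc, ← mul_div_assoc, ← add_div]
    gcongr

theorem outer_bounds_of_mem_region {n d ℓ : ℕ} (hℓ : ℓ < d) (hd : d < n) {p : Tuple d ℓ}
    (hp : p ∈ region n d ℓ) :
    rateSum d ℓ p.1 ≤ p.2.2 ∧
    ((d : ℝ) - ℓ) * (d + 1) * rateSum d ℓ p.1 ≤ p.2.1 + (d * (d - ℓ) - ℓ) * p.2.2 := by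
  have hcont : Continuous fun p : Tuple d ℓ => rateSum d ℓ p.1 := by
    unfold rateSum
    fun_prop
  have hclosed : IsClosed {p : Tuple d ℓ | rateSum d ℓ p.1 ≤ p.2.2 ∧
      ((d : ℝ) - ℓ) * (d + 1) * rateSum d ℓ p.1 ≤ p.2.1 + (d * (d - ℓ) - ℓ) * p.2.2} :=
    (isClosed_le hcont continuous_snd.snd).inter
      (isClosed_le (continuous_const.mul hcont) (by fun_prop))
  exact closure_minimal (fun p hp => hp.outer_bounds hℓ hd) hclosed hp

end Converse

end MDCSR

namespace MDCSR

open Finset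

/-! ### From coding schemes over finite alphabets to achievable tuples -/

section Scheme

/-- A bijection of keys matching the observations under `m` and `m'` shows that the conditional law
of `Y` does not depend on the message. -/
theorem mutualInfo_eq_zero_of_masking {μ Key γ δ : Type} [Fintype μ] [Fintype Key] [Nonempty μ]
    [Nonempty Key] (X : μ × Key → γ) (Y : μ × Key → δ)
    (hX : ∀ ω ω', X ω = X ω' ↔ ω.1 = ω'.1)
    (hY : ∀ m m', ∃ e : Key ≃ Key, ∀ κ, Y (m, κ) = Y (m', e κ)) : mutualInfo X Y = 0 := by
  classical
  have hcX (ω : μ × Key) : classCard (Setoid.ker X) ω = Fintype.card Key := by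
    rw [classCard, ← card_univ]
    refine card_bij' (fun ω' _ => ω'.2) (fun κ _ => (ω.1, κ)) (fun _ _ => mem_univ _) ?_ ?_ ?_
    · intro κ _
      simp [Setoid.ker_def, hX]
    · intro ω' h
      simp only [Setoid.ker_def, hX, mem_filter, mem_univ, true_and] at h
      rw [← h]
    · intro κ _
      rfl
  have hcXY (ω : μ × Key) : classCard (Setoid.ker X ⊓ Setoid.ker Y) ω =
      #{κ | Y (ω.1, κ) = Y ω} := by
    rw [classCard]
    refine card_bij' (fun ω' _ => ω'.2) (fun κ _ => (ω.1, κ)) ?_ ?_ ?_ ?_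
    · rintro ⟨m', κ'⟩ h
      obtain ⟨h1, h2⟩ := (mem_filter.1 h).2
      rw [Setoid.ker_def, hX] at h1
      simp only [mem_filter, mem_univ, true_and]
      simp only at h1
      rw [← h1]
      exact h2
    · intro κ h
      simp only [mem_filter, mem_univ, true_and] at h ⊢
      exact ⟨(hX _ _).2 rfl, h⟩
    · rintro ⟨m', κ'⟩ h
      have h1 := (mem_filter.1 h).2.1
      rw [Setoid.ker_def, hX] at h1
      exact Prod.ext h1.symm rfl
    · intro κ _
      rfl
  have hcY (ω : μ × Key) : classCard (Setoid.ker Y) ω =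
      Fintype.card μ * classCard (Setoid.ker X ⊓ Setoid.ker Y) ω := by
    rw [hcXY, classCard, card_filter, Fintype.sum_prod_type]
    rw [sum_congr rfl (g := fun _ => #{κ | Y (ω.1, κ) = Y ω}), sum_const, smul_eq_mul, card_univ]
    intro m _
    obtain ⟨e, he⟩ := hY m ω.1
    rw [← card_filter]
    refine card_equiv e fun κ => ?_
    simp only [mem_filter, mem_univ, true_and, Setoid.ker_def]
    rw [he]
  have hμ : (Fintype.card μ : ℝ) ≠ 0 := by exact_mod_cast Fintype.card_ne_zero
  have hK : (Fintype.card Key : ℝ) ≠ 0 := by exact_mod_cast Fintype.card_ne_zero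
  rw [mutualInfo_eq]
  unfold partEntropy
  rw [← mul_add, ← mul_sub, ← sum_add_distrib, ← sum_sub_distrib, sum_eq_zero, mul_zero]
  intro ω _
  have hpos : (classCard (Setoid.ker X ⊓ Setoid.ker Y) ω : ℝ) ≠ 0 := by
    exact_mod_cast (classCard_pos _ ω).ne'
  rw [hcX, hcY, Fintype.card_prod]
  push_cast
  rw [Real.log_mul hμ hK, Real.log_mul hμ hpos]
  ring

variable {n d ℓ : ℕ}

/-- A coding scheme over arbitrary finite alphabets yields an achievable tuple. -/
theorem achievable_of_scheme (Msg : Level 1 d → Type) [∀ j, Fintype (Msg j)]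
    [∀ j, Nonempty (Msg j)] (Key W D : Type) [Fintype Key] [Nonempty Key] [Fintype W] [Nonempty W]
    [Fintype D] [Nonempty D] (enc : Fin n → (∀ j, Msg j) × Key → W)
    (rep : Fin n → Fin n → W → D)
    (hone : ∀ j : Level 1 d, j.1 ≤ ℓ → Fintype.card (Msg j) = 1)
    (hpos : 0 < ∑ t : Level (ℓ + 1) d, Real.log (Fintype.card (Msg t.incl)))
    (hrec : ∀ A : Finset (Fin n), #A ∈ Icc (ℓ + 1) d → ∀ ω ω',
      (∀ i ∈ A, enc i ω = enc i ω') → ∀ j : Level 1 d, j.1 = #A → ω.1 j = ω'.1 j)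
    (hreg : ∀ (i : Fin n) (B : Finset (Fin n)), #B = d → i ∉ B → ∀ ω ω',
      (∀ i' ∈ B, rep i i' (enc i' ω) = rep i i' (enc i' ω')) → enc i ω = enc i ω')
    (hsec : ∀ E : Finset (Fin n), #E = ℓ → ∀ m m', ∃ e : Key ≃ Key, ∀ κ, ∀ i ∈ E, ∀ i',
      rep i i' (enc i' (m, κ)) = rep i i' (enc i' (m', e κ))) :
    Achievable n d ℓ
      (fun j => Real.log (Fintype.card (Msg j.incl)) /
          ∑ t : Level (ℓ + 1) d, Real.log (Fintype.card (Msg t.incl)),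
        Real.log (Fintype.card W) / ∑ t : Level (ℓ + 1) d, Real.log (Fintype.card (Msg t.incl)),
        Real.log (Fintype.card D) / ∑ t : Level (ℓ + 1) d, Real.log (Fintype.card (Msg t.incl))) := by
  classical
  let N : Level 1 d → ℕ := fun j => Fintype.card (Msg j)
  let K := Fintype.card Key
  let eM : ∀ j, Fin (N j) ≃ Msg j := fun j => (Fintype.equivFin (Msg j)).symm
  let eK : Fin K ≃ Key := (Fintype.equivFin Key).symm
  let eW := Fintype.equivFin W
  let eD := Fintype.equivFin D
  let φ : Sample N K → (∀ j, Msg j) × Key := fun ω => (fun j => eM j (ω.1 j), eK ω.2)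
  have hN (j : Level 1 d) : 0 < N j := Fintype.card_pos
  have : ∀ j, Nonempty (Fin (N j)) := fun j => ⟨⟨0, hN j⟩⟩
  have : Nonempty (Fin K) := ⟨⟨0, Fintype.card_pos⟩⟩
  let sto : Fin n → Sample N K → Fin (Fintype.card W) := fun i ω => eW (enc i (φ ω))
  let rp : Fin n → Fin n → Fin (Fintype.card W) → Fin (Fintype.card D) :=
    fun i i' v => eD (rep i i' (eW.symm v))
  have hrp (i i' : Fin n) (ω : Sample N K) : rp i i' (sto i' ω) = eD (rep i i' (enc i' (φ ω))) := by
    simp [rp, sto]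
  -- The decoders pick any sample compatible with the observation; `hrec` and `hreg` make the
  -- decoded value independent of the choice.
  let c : Code n d N K (Fintype.card W) (Fintype.card D) :=
    { enc := sto
      dec := fun A hA v => (Function.invFun (fun ω (i : A) => sto i.1 ω) v).1 ⟨#A, hA⟩
      repairEnc := fun i _ i' => rp i i'.1
      repairDec := fun i B v =>
        sto i (Function.invFun (fun ω (i' : B.1) => rp i i'.1 (sto i'.1 ω)) v) }
  refine ⟨N, K, Fintype.card W, Fintype.card D, c, hN, Fintype.card_pos, Fintype.card_pos,
    Fintype.card_pos, hone, hpos, rfl, rfl, fun _ => rfl, ?_, ?_, ?_⟩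
  · intro A hA ω
    have h := Function.invFun_eq (f := fun ω (i : A) => sto i.1 ω) ⟨ω, rfl⟩
    set ω' := Function.invFun (fun ω (i : A) => sto i.1 ω) fun i => sto i.1 ω
    refine (eM _).injective (hrec A hA (φ ω') (φ ω) ?_ _ rfl)
    intro i hi
    exact eW.injective (congrFun h ⟨i, hi⟩)
  · intro i B ω
    have h := Function.invFun_eq
      (f := fun ω (i' : B.1) => rp i i'.1 (sto i'.1 ω)) ⟨ω, rfl⟩
    set ω' := Function.invFun (fun ω (i' : B.1) => rp i i'.1 (sto i'.1 ω))
      fun i' => rp i i'.1 (sto i'.1 ω)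
    refine congrArg eW (hreg i B.1 B.2.1 B.2.2 (φ ω') (φ ω) ?_)
    intro i' hi'
    have h' := congrFun h ⟨i', hi'⟩
    simp only [hrp] at h'
    exact eD.injective h'
  · intro E hE
    refine mutualInfo_eq_zero_of_masking _ _ ?_ ?_
    · intro ω ω'
      refine ⟨fun h => funext fun i => ?_, fun h => by simp only [h]⟩
      by_cases hi : i.1 ≤ ℓ
      · have : Subsingleton (Fin (N i)) := by
          simp only [N]
          rw [hone i hi]
          infer_instance
        exact Subsingleton.elim _ _
      · exact congrFun h ⟨i.1, mem_Icc.2 ⟨by omega, (mem_Icc.1 i.2).2⟩⟩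
    · intro m m'
      obtain ⟨e, he⟩ := hsec E hE (fun j => eM j (m j)) fun j => eM j (m' j)
      refine ⟨eK.trans (e.trans eK.symm), fun κ => ?_⟩
      funext i B i'
      change rp i.1 i'.1 (sto i'.1 _) = rp i.1 i'.1 (sto i'.1 _)
      rw [hrp, hrp]
      refine congrArg eD ((he (eK κ) i.1 i.2 i'.1).trans ?_)
      simp [φ]

end Scheme

end MDCSR

namespace MDCSR

open Finset Matrix

/-! ### Product matrices -/

section ProductMatrix

variable {F : Type} [Field F] {d ℓ j : ℕ}

/-- The positions of the message symbols of level `j` in a product matrix. -/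
abbrev MsgIdx (d ℓ j : ℕ) : Type := {a : Fin d × Fin d // (ℓ ≤ a.1 ∧ (a.1 : ℕ) < j) ∧ a.1 ≤ a.2}

/-- The positions of the key symbols in a product matrix. -/
abbrev KeyIdx (d ℓ : ℕ) : Type := {a : Fin d × Fin d // (a.1 : ℕ) < ℓ ∧ a.1 ≤ a.2}

/-- The symmetric matrix filled with the key symbols in its first `ℓ` rows and columns, and with
the message symbols elsewhere in the first `j` rows and columns. -/
def productMatrix (m : MsgIdx d ℓ j → F) (κ : KeyIdx d ℓ → F) : Matrix (Fin d) (Fin d) F :=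
  fun a b => if h : ((min a b : Fin d) : ℕ) < ℓ then κ ⟨(min a b, max a b), h, min_le_max⟩ else
    if h' : ((min a b : Fin d) : ℕ) < j then
      m ⟨(min a b, max a b), ⟨not_lt.1 h, h'⟩, min_le_max⟩ else 0

theorem productMatrix_symm (m : MsgIdx d ℓ j → F) (κ : KeyIdx d ℓ → F) (a b : Fin d) :
    productMatrix m κ a b = productMatrix m κ b a := by
  simp only [productMatrix, min_comm b a, max_comm b a]

theorem productMatrix_transpose (m : MsgIdx d ℓ j → F) (κ : KeyIdx d ℓ → F) :
    (productMatrix m κ)ᵀ = productMatrix m κ := by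
  ext a b
  exact productMatrix_symm m κ b a

theorem productMatrix_eq_zero (hj : ℓ ≤ j) (m : MsgIdx d ℓ j → F) (κ : KeyIdx d ℓ → F)
    {a b : Fin d} (ha : j ≤ a) (hb : j ≤ b) : productMatrix m κ a b = 0 := by
  have h : j ≤ ((min a b : Fin d) : ℕ) := by
    rcases min_choice a b with h | h <;> rw [h] <;> assumption
  rw [productMatrix, dif_neg (by omega), dif_neg (by omega)]

theorem productMatrix_add (m m' : MsgIdx d ℓ j → F) (κ κ' : KeyIdx d ℓ → F) :
    productMatrix (m + m') (κ + κ') = productMatrix m κ + productMatrix m' κ' := by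
  ext a b
  simp only [productMatrix, Matrix.add_apply]
  split_ifs <;> simp

theorem productMatrix_apply_msgIdx (m : MsgIdx d ℓ j → F) (κ : KeyIdx d ℓ → F)
    (i : MsgIdx d ℓ j) : productMatrix m κ i.1.1 i.1.2 = m i := by
  obtain ⟨⟨a, b⟩, ⟨h1, h2⟩, h3⟩ := i
  simp only at h1 h2 h3
  simp only [productMatrix, min_eq_left h3, max_eq_right h3]
  rw [dif_neg (by omega), dif_pos h2]

theorem exists_productMatrix_eq (m : MsgIdx d ℓ j → F) (A : Matrix (Fin d) (Fin d) F)
    (hA : Aᵀ = A)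
    (hblock : ∀ a b : Fin d, ℓ ≤ a → ℓ ≤ b → A a b = productMatrix (ℓ := ℓ) m 0 a b) :
    ∃ κ : KeyIdx d ℓ → F, productMatrix m κ = A := by
  refine ⟨fun i => A i.1.1 i.1.2, ?_⟩
  ext a b
  by_cases h : ((min a b : Fin d) : ℕ) < ℓ
  · rw [productMatrix, dif_pos h]
    simp only
    rcases le_total a b with hab | hab
    · rw [min_eq_left hab, max_eq_right hab]
    · rw [min_eq_right hab, max_eq_left hab]
      exact congrFun (congrFun hA a) b
  · have ha : ℓ ≤ a := (not_lt.1 h).trans (min_le_left a b)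
    have hb : ℓ ≤ b := (not_lt.1 h).trans (min_le_right a b)
    rw [hblock a b ha hb, productMatrix, productMatrix, dif_neg h, dif_neg h]

/-- The encoding vector at the evaluation point `t`. -/
def powVec (d : ℕ) (t : F) : Fin d → F := fun a => t ^ (a : ℕ)

/-- The products are values of the polynomial with coefficients `v`, of degree below `k`, which
would have at least `k` roots. -/
theorem eq_zero_of_dotProduct_powVec {ι : Type} {x : ι → F} (hx : Function.Injective x)
    {A : Finset ι} {k : ℕ} (hA : k ≤ #A) {v : Fin d → F} (hv : ∀ a : Fin d, k ≤ a → v a = 0)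
    (h : ∀ i ∈ A, v ⬝ᵥ powVec d (x i) = 0) : v = 0 := by
  classical
  set P : Polynomial F := ∑ a : Fin d, Polynomial.C (v a) * Polynomial.X ^ (a : ℕ) with hP
  have hcoeff (a : Fin d) : P.coeff a = v a := by
    rw [hP, Polynomial.finsetSum_coeff]
    simp [Polynomial.coeff_C_mul, Polynomial.coeff_X_pow, Fin.val_inj]
  have hP0 : P = 0 := by
    refine Polynomial.eq_zero_of_degree_lt_of_eval_index_eq_zero A hx.injOn ?_ ?_
    · refine lt_of_lt_of_le ?_ (Nat.cast_le.2 hA)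
      rw [Polynomial.degree_lt_iff_coeff_zero]
      intro a ha
      rw [hP, Polynomial.finsetSum_coeff]
      refine sum_eq_zero fun b _ => ?_
      rw [Polynomial.coeff_C_mul, Polynomial.coeff_X_pow]
      split_ifs with hab
      · rw [hv b (hab ▸ ha), zero_mul]
      · rw [mul_zero]
    · intro i hi
      rw [hP, Polynomial.eval_finsetSum, ← h i hi]
      simp [dotProduct, powVec]
  funext a
  rw [← hcoeff, hP0, Polynomial.coeff_zero, Pi.zero_apply]

/-- Rows of index at least `j` are supported in the first `j` columns, so they vanish. By symmetry
the columns of index at least `j` vanish too, and then every row is supported in the first `j`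
columns. -/
theorem productMatrix_eq_zero_of_mulVec {ι : Type} {x : ι → F} (hx : Function.Injective x)
    {A : Finset ι} (hj : ℓ ≤ j) (hA : j ≤ #A) (m : MsgIdx d ℓ j → F) (κ : KeyIdx d ℓ → F)
    (h : ∀ i ∈ A, productMatrix m κ *ᵥ powVec d (x i) = 0) : productMatrix m κ = 0 := by
  have h1 (a : Fin d) (ha : j ≤ a) : productMatrix m κ a = 0 :=
    eq_zero_of_dotProduct_powVec hx hA (fun b hb => productMatrix_eq_zero hj m κ ha hb)
      fun i hi => congrFun (h i hi) a
  funext a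
  refine eq_zero_of_dotProduct_powVec hx hA (fun b hb => ?_) fun i hi => congrFun (h i hi) a
  rw [productMatrix_symm, h1 b hb, Pi.zero_apply]

theorem exists_remainder {ι : Type} {x : ι → F} (hx : Function.Injective x) (E : Finset ι)
    (hE : #E < d) (b : ℕ) : ∃ r : Fin d → F, (∀ a : Fin d, #E ≤ a → r a = 0) ∧
      ∀ i ∈ E, r ⬝ᵥ powVec d (x i) = x i ^ b := by
  classical
  set P := Lagrange.interpolate E x fun i => x i ^ b
  have hdeg : P.degree < #E := Lagrange.degree_interpolate_lt _ hx.injOn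
  rw [Polynomial.degree_lt_iff_coeff_zero] at hdeg
  refine ⟨fun a => P.coeff a, fun a ha => hdeg a ha, fun i hi => ?_⟩
  have h1 : P.eval (x i) = x i ^ b := Lagrange.eval_interpolate_at_node _ hx.injOn hi
  have h2 : P.natDegree < d := by
    by_cases hP : P = 0
    · rw [hP, Polynomial.natDegree_zero]
      omega
    · rw [Polynomial.natDegree_lt_iff_degree_lt hP, Polynomial.degree_lt_iff_coeff_zero]
      exact fun a ha => hdeg a (by omega)
  rw [← h1, Polynomial.eval_eq_sum_range' h2,
    ← Fin.sum_univ_eq_sum_range fun a => P.coeff a * x i ^ a]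
  rfl

theorem exists_masking_key {ι : Type} {x : ι → F} (hx : Function.Injective x) {E : Finset ι}
    (hE : #E = ℓ) (hd : ℓ < d) (m : MsgIdx d ℓ j → F) :
    ∃ κ : KeyIdx d ℓ → F, ∀ i ∈ E, productMatrix m κ *ᵥ powVec d (x i) = 0 := by
  classical
  choose r hr0 hr using fun b : Fin d => exists_remainder hx E (by omega : #E < d) (b : ℕ)
  -- Row `b ≥ ℓ` of `R` represents `X ^ b` minus its interpolant of degree below `ℓ` on `E`, so `R`
  -- kills the vectors of `E`. Its columns of index at least `ℓ` are those of the identity, so `Rᵀ *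
  -- C * R` keeps the message block of `C`, and all its other entries are free key symbols.
  set R : Matrix (Fin d) (Fin d) F :=
    fun b => if (b : ℕ) < ℓ then 0 else Pi.single b 1 - r b with hR
  have hRcol (c b : Fin d) (hb : ℓ ≤ b) : R c b = (1 : Matrix (Fin d) (Fin d) F) c b := by
    simp only [hR]
    split_ifs with hc
    · rw [Matrix.one_apply_ne (by rintro rfl; omega), Pi.zero_apply]
    · rw [Pi.sub_apply, hr0 c b (by omega), sub_zero, Matrix.one_apply, Pi.single_apply]
      simp only [eq_comm]
  have hRmul (i) (hi : i ∈ E) : R *ᵥ powVec d (x i) = 0 := by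
    funext b
    rw [mulVec, hR]
    simp only
    split_ifs with hb
    · simp
    · rw [sub_dotProduct, hr b i hi, single_dotProduct]
      simp [powVec]
  set C := productMatrix (ℓ := ℓ) m 0 with hC
  obtain ⟨κ, hκ⟩ := exists_productMatrix_eq m (Rᵀ * C * R)
    (by
      rw [transpose_mul, transpose_mul, transpose_transpose, hC, productMatrix_transpose,
        Matrix.mul_assoc])
    (by
      intro a b ha hb
      rw [← hC, Matrix.mul_apply]
      simp_rw [hRcol _ b hb]
      rw [← Matrix.mul_apply, Matrix.mul_one, Matrix.mul_apply]
      simp_rw [Matrix.transpose_apply, hRcol _ a ha, Matrix.one_apply]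
      simp)
  refine ⟨κ, fun i hi => ?_⟩
  rw [hκ, ← mulVec_mulVec, hRmul i hi, mulVec_zero]

theorem sum_sub_eq_Tsum {d ℓ j : ℕ} (hj : ℓ ≤ j) (hd : j ≤ d) :
    ((∑ a ∈ Ico ℓ j, (d - a) : ℕ) : ℝ) = Tsum d j ℓ := by
  induction j, hj using Nat.le_induction with
  | base => simp [Tsum_self]
  | succ j hj ih =>
    rw [sum_Ico_succ_top hj, Tsum_succ hj, Nat.cast_add, ih (by omega), Nat.cast_sub (by omega)]

theorem card_msgIdx {d ℓ j : ℕ} (hj : ℓ ≤ j) (hd : j ≤ d) :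
    (Fintype.card (MsgIdx d ℓ j) : ℝ) = Tsum d j ℓ := by
  rw [← sum_sub_eq_Tsum hj hd, Fintype.card_subtype, card_filter, Fintype.sum_prod_type]
  congr 1
  have h (a : Fin d) : ∑ b : Fin d, (if ((ℓ ≤ (a : ℕ) ∧ (a : ℕ) < j) ∧ a ≤ b) then 1 else 0) =
      if ℓ ≤ (a : ℕ) ∧ (a : ℕ) < j then d - (a : ℕ) else 0 := by
    by_cases ha : ℓ ≤ (a : ℕ) ∧ (a : ℕ) < j
    · simp only [ha, and_self, true_and, if_true]
      rw [← card_filter, filter_le_eq_Ici, Fin.card_Ici]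
    · simp [ha]
  simp only
  rw [sum_congr rfl fun a _ => h a,
    Fin.sum_univ_eq_sum_range fun a => if ℓ ≤ a ∧ a < j then d - a else 0, ← sum_filter]
  refine sum_congr ?_ fun _ _ => rfl
  ext a
  simp only [mem_filter, mem_range, mem_Ico]
  omega

end ProductMatrix

end MDCSR

namespace MDCSR

open Finset Matrix Filter Topology

/-! ### Achievability of the intersection point and the SRK points -/

section Achievability

variable {n d ℓ : ℕ}

/-- The combined rate of `mult j` product-matrix codes for each level `j`, jointly encoded. -/
theorem achievable_productMatrix (hℓ : ℓ < d) (mult : ℕ → ℕ)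
    (hpos : 0 < ∑ t : Level (ℓ + 1) d, (mult t.1 : ℝ) * Tsum d t.1 ℓ) :
    Achievable n d ℓ
      (fun j => (mult j.1 : ℝ) * Tsum d j.1 ℓ /
          ∑ t : Level (ℓ + 1) d, (mult t.1 : ℝ) * Tsum d t.1 ℓ,
        d * (∑ t : Level (ℓ + 1) d, (mult t.1 : ℝ)) /
          ∑ t : Level (ℓ + 1) d, (mult t.1 : ℝ) * Tsum d t.1 ℓ,
        (∑ t : Level (ℓ + 1) d, (mult t.1 : ℝ)) /
          ∑ t : Level (ℓ + 1) d, (mult t.1 : ℝ) * Tsum d t.1 ℓ) := by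
  classical
  obtain ⟨p, hnp, hp⟩ := Nat.exists_infinite_primes n
  have : Fact p.Prime := ⟨hp⟩
  let x : Fin n → ZMod p := fun i => ((i : ℕ) : ZMod p)
  have hx : Function.Injective x := by
    intro i i' h
    have h' := (ZMod.natCast_eq_natCast_iff' _ _ _).1 h
    rw [Nat.mod_eq_of_lt (by omega), Nat.mod_eq_of_lt (by omega)] at h'
    exact Fin.ext h'
  let Copy : Type := Σ j : Level (ℓ + 1) d, Fin (mult j.1)
  let Msg : Level 1 d → Type := fun j => Fin (mult j.1) → MsgIdx d ℓ j.1 → ZMod p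
  let Key : Type := Copy → KeyIdx d ℓ → ZMod p
  let mat : (∀ j, Msg j) × Key → Copy → Matrix (Fin d) (Fin d) (ZMod p) :=
    fun ω q => productMatrix (ω.1 q.1.incl q.2) (ω.2 q)
  let enc : Fin n → (∀ j, Msg j) × Key → Copy → Fin d → ZMod p :=
    fun i ω q => mat ω q *ᵥ powVec d (x i)
  let rep : Fin n → Fin n → (Copy → Fin d → ZMod p) → Copy → ZMod p :=
    fun i _ v q => powVec d (x i) ⬝ᵥ v q
  have hlogp : 0 < Real.log p := Real.log_pos (by exact_mod_cast hp.one_lt)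
  -- By symmetry of the matrix, what `i'` sends to `i` is a function of the content of `i`. Hence
  -- `d` helpers determine that content, and an eavesdropper on the repairs of `E` sees no more than
  -- the contents of `E`.
  have hbil (i i' : Fin n) (ω : (∀ j, Msg j) × Key) (q : Copy) :
      rep i i' (enc i' ω) q = enc i ω q ⬝ᵥ powVec d (x i') := by
    simp only [rep, enc, mat]
    rw [dotProduct_mulVec, ← mulVec_transpose, productMatrix_transpose]
  have hsub (ω ω' : (∀ j, Msg j) × Key) (q : Copy) :
      mat ω q = mat ω' q + productMatrix (ω.1 q.1.incl q.2 - ω'.1 q.1.incl q.2)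
        (ω.2 q - ω'.2 q) := by
    simp only [mat]
    rw [← productMatrix_add, add_sub_cancel, add_sub_cancel]
  have hMsg (j : Level (ℓ + 1) d) : Real.log (Fintype.card (Msg j.incl)) =
      mult j.1 * Tsum d j.1 ℓ * Real.log p := by
    have hj := mem_Icc.1 j.2
    rw [← card_msgIdx (d := d) (ℓ := ℓ) (j := j.1) (by omega) hj.2]
    simp only [Msg, Fintype.card_fun, Fintype.card_fin, ZMod.card]
    push_cast
    rw [Real.log_pow, Real.log_pow, ← mul_assoc]
    rfl
  have hsum : ∑ t : Level (ℓ + 1) d, Real.log (Fintype.card (Msg t.incl)) =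
      (∑ t : Level (ℓ + 1) d, (mult t.1 : ℝ) * Tsum d t.1 ℓ) * Real.log p := by
    rw [sum_mul]
    exact sum_congr rfl fun t _ => hMsg t
  have hcopy : (Fintype.card Copy : ℝ) = ∑ t : Level (ℓ + 1) d, (mult t.1 : ℝ) := by
    simp only [Copy, Fintype.card_sigma, Fintype.card_fin]
    push_cast
    rfl
  have hD : Real.log (Fintype.card (Copy → ZMod p)) =
      (∑ t : Level (ℓ + 1) d, (mult t.1 : ℝ)) * Real.log p := by
    rw [Fintype.card_fun, ZMod.card, ← hcopy]
    push_cast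
    rw [Real.log_pow]
  have hW : Real.log (Fintype.card (Copy → Fin d → ZMod p)) =
      d * (∑ t : Level (ℓ + 1) d, (mult t.1 : ℝ)) * Real.log p := by
    rw [Fintype.card_fun, Fintype.card_fun, ZMod.card, Fintype.card_fin, ← hcopy]
    push_cast
    rw [Real.log_pow, Real.log_pow]
    ring
  have key := achievable_of_scheme (n := n) (d := d) (ℓ := ℓ) Msg Key
    (Copy → Fin d → ZMod p) (Copy → ZMod p) enc rep ?_ ?_ ?_ ?_ ?_
  · convert key using 2
    · funext j
      rw [hsum, hMsg, mul_div_mul_right _ _ hlogp.ne']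
    · rw [hsum, hW, hD, mul_div_mul_right _ _ hlogp.ne', mul_div_mul_right _ _ hlogp.ne']
  · intro j hj
    have : IsEmpty (MsgIdx d ℓ j.1) := ⟨fun a => by
      have := a.2.1
      omega⟩
    rw [Fintype.card_eq_one_iff_nonempty_unique]
    exact ⟨⟨⟨fun _ a => isEmptyElim a⟩, fun f => by
      funext _ a
      exact isEmptyElim a⟩⟩
  · rw [hsum]
    positivity
  · intro A hA ω ω' h j hj
    rw [mem_Icc, ← hj] at hA
    funext c
    let q : Copy := ⟨⟨j.1, mem_Icc.2 hA⟩, c⟩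
    have h0 := productMatrix_eq_zero_of_mulVec hx (A := A) (by omega : ℓ ≤ j.1) hj.le
      (ω.1 j c - ω'.1 j c) (ω.2 q - ω'.2 q) (by
        intro i hi
        have h1 := congrFun (h i hi) q
        simp only [enc] at h1
        rw [hsub ω ω' q, add_mulVec, add_eq_left] at h1
        exact h1)
    funext a
    have h1 := productMatrix_apply_msgIdx (ω.1 j c - ω'.1 j c) (ω.2 q - ω'.2 q) a
    rw [h0] at h1
    exact (sub_eq_zero.1 h1.symm)
  · intro i B hB _ ω ω' h
    funext q
    rw [← sub_eq_zero]
    refine eq_zero_of_dotProduct_powVec hx (A := B) hB.ge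
      (fun a ha => absurd a.2 (by omega)) fun i' hi' => ?_
    have h1 := congrFun (h i' hi') q
    rw [hbil, hbil] at h1
    rw [sub_dotProduct, h1, sub_self]
  · intro E hE m m'
    choose δ hδ using fun q : Copy =>
      exists_masking_key hx hE hℓ (m' q.1.incl q.2 - m q.1.incl q.2)
    -- By linearity, translating the key by the masking key of `m' - m` leaves the contents of the
    -- nodes in `E` unchanged.
    refine ⟨Equiv.addRight δ, fun κ i hi i' => ?_⟩
    funext q
    rw [hbil, hbil]
    congr 1
    simp only [enc]
    rw [hsub (m', Equiv.addRight δ κ) (m, κ) q, add_mulVec]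
    have h1 : (Equiv.addRight δ κ) q - κ q = δ q := by simp
    simp only [h1]
    rw [hδ q i hi, add_zero]

theorem rateSum_point_mem_region (hℓ : ℓ < d) (B : Level (ℓ + 1) d → ℝ) (hB : ∀ j, 0 ≤ B j)
    (hB1 : ∑ j, B j = 1) :
    (B, (d : ℝ) * rateSum d ℓ B, rateSum d ℓ B) ∈ region n d ℓ := by
  classical
  have hT (j : Level (ℓ + 1) d) : 0 < Tsum d j.1 ℓ := by
    have := mem_Icc.1 j.2
    exact Tsum_pos this.2 (by omega)
  -- A copy at level `t` carries `Tsum d t ℓ` message symbols, so about `N * B t / Tsum d t ℓ`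
  -- copies realize rate `B t` as `N` grows.
  let mult : ℕ → ℕ → ℕ := fun N t => if h : t ∈ Icc (ℓ + 1) d then
    ⌊(Tsum d t ℓ)⁻¹ * B ⟨t, h⟩ * (N : ℝ)⌋₊ else 0
  have hmult (N : ℕ) (j : Level (ℓ + 1) d) :
      mult N j.1 = ⌊(Tsum d j.1 ℓ)⁻¹ * B j * (N : ℝ)⌋₊ := by
    simp only [mult, dif_pos j.2]
  have hlim (j : Level (ℓ + 1) d) : Tendsto (fun N : ℕ => (mult N j.1 : ℝ) / N) atTop
      (𝓝 ((Tsum d j.1 ℓ)⁻¹ * B j)) := by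
    simp_rw [hmult]
    exact (tendsto_nat_floor_mul_div_atTop
      (mul_nonneg (inv_nonneg.2 (hT j).le) (hB j))).comp tendsto_natCast_atTop_atTop
  have hnum (j : Level (ℓ + 1) d) :
      Tendsto (fun N : ℕ => (mult N j.1 : ℝ) * Tsum d j.1 ℓ / N) atTop (𝓝 (B j)) := by
    have := (hlim j).mul_const (Tsum d j.1 ℓ)
    rw [mul_right_comm, inv_mul_cancel₀ (hT j).ne', one_mul] at this
    exact this.congr fun N => by ring
  have hden : Tendsto (fun N : ℕ => (∑ t : Level (ℓ + 1) d, (mult N t.1 : ℝ) * Tsum d t.1 ℓ) / N)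
      atTop (𝓝 1) := by
    rw [← hB1]
    simp_rw [sum_div]
    exact tendsto_finsetSum _ fun j _ => hnum j
  have hcount : Tendsto (fun N : ℕ => (∑ t : Level (ℓ + 1) d, (mult N t.1 : ℝ)) / N)
      atTop (𝓝 (rateSum d ℓ B)) := by
    unfold rateSum
    simp_rw [sum_div]
    exact tendsto_finsetSum _ fun j _ => hlim j
  have hcancel {f : ℕ → ℝ} {a : ℝ} (hf : Tendsto (fun N : ℕ => f N / N) atTop (𝓝 a)) :
      Tendsto (fun N => f N / ∑ t : Level (ℓ + 1) d, (mult N t.1 : ℝ) * Tsum d t.1 ℓ)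
        atTop (𝓝 a) := by
    have := hf.div hden one_ne_zero
    rw [div_one] at this
    refine this.congr' ?_
    filter_upwards [eventually_gt_atTop 0] with N hN
    exact div_div_div_cancel_right₀ (by exact_mod_cast hN.ne') _ _
  refine mem_closure_of_tendsto (b := atTop) (f := fun N : ℕ =>
    ((fun j => (mult N j.1 : ℝ) * Tsum d j.1 ℓ /
          ∑ t : Level (ℓ + 1) d, (mult N t.1 : ℝ) * Tsum d t.1 ℓ,
        d * (∑ t : Level (ℓ + 1) d, (mult N t.1 : ℝ)) /
          ∑ t : Level (ℓ + 1) d, (mult N t.1 : ℝ) * Tsum d t.1 ℓ,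
        (∑ t : Level (ℓ + 1) d, (mult N t.1 : ℝ)) /
          ∑ t : Level (ℓ + 1) d, (mult N t.1 : ℝ) * Tsum d t.1 ℓ) : Tuple d ℓ)) ?_ ?_
  · refine Tendsto.prodMk_nhds (tendsto_pi_nhds.2 fun j => hcancel (hnum j))
      (Tendsto.prodMk_nhds (hcancel ?_) (hcancel hcount))
    exact (hcount.const_mul (d : ℝ)).congr fun N => by rw [mul_div_assoc]
  · filter_upwards [hden.eventually_const_lt zero_lt_one, eventually_gt_atTop 0] with N hN hN0
    refine achievable_productMatrix hℓ (mult N) ?_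
    have hN0 : (0 : ℝ) < N := by exact_mod_cast hN0
    exact (div_pos_iff_of_pos_right hN0).1 hN

theorem rateSum_single (j : Level (ℓ + 1) d) :
    rateSum d ℓ (Pi.single j 1) = (Tsum d j.1 ℓ)⁻¹ := by
  rw [rateSum, sum_eq_single j]
  · simp
  · intro i _ hij
    simp [hij]
  · simp

theorem srk_point_mem (hℓ : ℓ < d) (j : Level (ℓ + 1) d) :
    ((d : ℝ) * (Tsum d j.1 ℓ)⁻¹, (Tsum d j.1 ℓ)⁻¹) ∈ srcRegion n d ℓ j := by
  have := rateSum_point_mem_region (n := n) hℓ (Pi.single j 1)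
    (fun i => by by_cases h : i = j <;> simp [h]) (by simp)
  rw [rateSum_single] at this
  exact this

end Achievability

end MDCSR

/-! ### The theorem -/

theorem theorem1 (n d ℓ : ℕ) (hℓ : ℓ < d) (hd : d < n) :
    -- the two outer bounds
    (∀ (B : MDCSR.Level (ℓ + 1) d → ℝ) (α β : ℝ), (B, α, β) ∈ MDCSR.region n d ℓ →
      MDCSR.rateSum d ℓ B ≤ β ∧
      ((d : ℝ) - ℓ) * ((d : ℝ) + 1) * MDCSR.rateSum d ℓ B
        ≤ α + ((d : ℝ) * ((d : ℝ) - ℓ) - ℓ) * β) ∧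
    -- the intersection of the two bounding lines
    (∀ (B : MDCSR.Level (ℓ + 1) d → ℝ) (α β : ℝ),
      (β = MDCSR.rateSum d ℓ B ∧
        α + ((d : ℝ) * ((d : ℝ) - ℓ) - ℓ) * β
          = ((d : ℝ) - ℓ) * ((d : ℝ) + 1) * MDCSR.rateSum d ℓ B) ↔
      (α, β) = ((d : ℝ) * MDCSR.rateSum d ℓ B, MDCSR.rateSum d ℓ B)) ∧
    -- the SRK points
    (∀ j : MDCSR.Level (ℓ + 1) d,
      ((d : ℝ) * (MDCSR.Tsum d j.1 ℓ)⁻¹, (MDCSR.Tsum d j.1 ℓ)⁻¹) ∈ MDCSR.srcRegion n d ℓ j) ∧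
    -- separate coding achieves the MBR point
    (∀ B : MDCSR.Level (ℓ + 1) d → ℝ, (∀ j, 0 ≤ B j) → ∑ j, B j = 1 →
      MDCSR.IsMBRPoint (MDCSR.regionAt n d ℓ B)
        ((d : ℝ) * MDCSR.rateSum d ℓ B, MDCSR.rateSum d ℓ B) ∧
      ((d : ℝ) * MDCSR.rateSum d ℓ B, MDCSR.rateSum d ℓ B) ∈ MDCSR.separateRegion n d ℓ B) := by
  refine ⟨fun B α β h => MDCSR.outer_bounds_of_mem_region hℓ hd h, fun B α β => ?_,
    MDCSR.srk_point_mem hℓ, fun B hB hB1 => ⟨⟨?_, ?_⟩, ?_⟩⟩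
  · rw [Prod.mk.injEq]
    constructor
    · rintro ⟨rfl, h⟩
      exact ⟨by linarith, rfl⟩
    · rintro ⟨rfl, rfl⟩
      exact ⟨rfl, by ring⟩
  · exact MDCSR.rateSum_point_mem_region hℓ B hB hB1
  · intro q hq
    obtain ⟨h1, h2⟩ := MDCSR.outer_bounds_of_mem_region hℓ hd hq
    refine ⟨h1, fun h => ?_⟩
    simp only at h h2 ⊢
    -- With `β` equal to the rate sum, the second bound reads `α ≥ d β`, because `(d - ℓ)(d + 1) -
    -- (d (d - ℓ) - ℓ) = d`.
    rw [h] at h2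
    linarith
  · refine ⟨fun j => ((d : ℝ) * (MDCSR.Tsum d j.1 ℓ)⁻¹, (MDCSR.Tsum d j.1 ℓ)⁻¹),
      MDCSR.srk_point_mem hℓ, ?_⟩
    rw [MDCSR.rateSum, Finset.mul_sum]
    simp only [mul_assoc]
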